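/- Let $L,H,\alpha,k>0$, $0\le A\le L/2$, $0\le B\le H/2$, and $\Theta,w\in\mathbb R$. Let $$\bar x(t)=\tfrac L2+A\cos wt,\qquad \bar y(t)=\tfrac H2+B\sin wt,\qquad Q(x,y,t)=\Theta\,\delta(x-\bar x(t))\,\delta(y-\bar y(t)),$$ and for integers $m,n\ge 1$ put $\mu_m=m\pi/L$, $\gamma_n=n\pi/H$, $\lambda_{mn}^2=\mu_m^2+\gamma_n^2$. **Notion of solution.** Let $V$ be the space of smooth functions $\varphi$ on $\mathbb R^2$ that are odd and $2L$-periodic in $x$ and odd and $2H$-periodic in $y$ (equivalently: functions smooth on $[0,L]\times[0,H]$ up to the boundary that vanish on the boundary together with all their iterated Laplacians), with the topology of uniform convergence of all derivatives, and let $V'$ be its dual. A function $f$ on $[0,L]\times[0,H]$ acts on $V$ by $\varphi\mapsto\int_0^L\!\int_0^H f\varphi\,dy\,dx$, the Laplacian acts on $V'$ by $\langle\Delta T,\varphi\rangle=\langle T,\Delta\varphi\rangle$ (this encodes zero Dirichlet data), and $\langle Q(t),\varphi\rangle=\Theta\varphi(\bar x(t),\bar y(t))$. Time derivatives of a family $T(t)\in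 V'$, $t\ge 0$, are taken after pairing with each $\varphi\in V$, and are one-sided at $t=0$. **(1) Dual-phase-lag equation.** Let $\tau_q>0$ and $\tau_T\ge 0$. The problem $$\Delta T+\tau_T\,\partial_t\Delta T+\tfrac1k\left(Q+\tau_q\,\partial_tQ\right)=\tfrac1\alpha\left(\partial_tT+\tau_q\,\partial_t^2T\right)\quad(t\ge0),\qquad T(0)=\partial_tT(0)=0,$$ with zero Dirichlet data on the boundary of $[0,L]\times[0,H]$, has a solution $T:[0,\infty)\to V'$ such that $t\mapsto\langle T(t),\varphi\rangle$ is $C^2$ on $[0,\infty)$ for every $\varphi\in V$. A family $T:[0,\infty)\to V'$ is such a solution if and only if for every $t\ge 0$ $$T(t)=\sum_{m,n\ge1}\frac{4\alpha\Theta}{LH\tau_q\beta_2k}\,P_{mn}(t)\,\sin\mu_mx\,\sin\gamma_ny,$$ where the series converges unconditionally in the sense of distributions (after pairing with every $\varphi\in V$); in particular the solution is unique. Here $$P_{mn}(t)=\int_0^t\Big(\sin\mu_m\bar x\,\sin\gamma_n\bar y+\tau_q\mu_m\bar x'\cos\mu_m\bar x\,\sin\gamma_n\bar y+\tau_q\gamma_n\bar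 y'\sin\mu_m\bar x\,\cos\gamma_n\bar y\Big)(\tau)\;e^{-\beta_1(t-\tau)}\sinh(\beta_2(t-\tau))\,d\tau,$$ $$\beta_1=\frac{1+\alpha\tau_T\lambda_{mn}^2}{2\tau_q},\qquad \beta_2=\frac{\sqrt{(1+\alpha\tau_T\lambda_{mn}^2)^2-4\alpha\tau_q\lambda_{mn}^2}}{2\tau_q},$$ $\beta_1,\beta_2$ depend on $m,n$, the square root is complex if the radicand is negative, and for those $(m,n)$ with $\beta_2=0$ the quotient $\sinh(\beta_2(t-\tau))/\beta_2$ is read as its limit $t-\tau$. If $\tau_T>0$, then for every $t\ge0$ the solution $T(t)$ is a function in $L^2([0,L]\times[0,H])$, and the series converges to it unconditionally in $L^2$. **(2) Classical heat equation ($\tau_q=\tau_T=0$).** The problem $\Delta T+\frac1kQ=\frac1\alpha\partial_tT$ for $t\ge0$, $T(0)=0$, with zero Dirichlet data, has a solution $T:[0,\infty)\to V'$ with $t\mapsto\langle T(t),\varphi\rangle$ in $C^1([0,\infty))$ for every $\varphi\in V$, and a family $T:[0,\infty)\to V'$ is such a solution if and only if for every $t\ge0$ $$T(t)=\sum_{m,n\ge1}\frac{4\alpha\Theta}{LHk}\,P_{mn}(t)\,\sin\mu_mx\,\sin\gamma_ny,\qquad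 P_{mn}(t)=\int_0^te^{-\alpha\lambda_{mn}^2(t-\tau)}\sin\mu_m\bar x(\tau)\,\sin\gamma_n\bar y(\tau)\,d\tau,$$ unconditionally in the sense of distributions. Moreover, for every $t\ge0$, $T(t)$ is a function in $L^2([0,L]\times[0,H])$ and the series converges to it unconditionally in $L^2$. -/

import Mathlib

open MeasureTheory Filter Topology
open scoped ContDiff

noncomputable section

/-! ### The test space and distributions with zero Dirichlet data on the plate -/

/-- Partial derivative in the first variable. -/
def partialX (φ : ℝ × ℝ → ℝ) : ℝ × ℝ → ℝ := fun p => fderiv ℝ φ p (1, 0)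

/-- Partial derivative in the second variable. -/
def partialY (φ : ℝ × ℝ → ℝ) : ℝ × ℝ → ℝ := fun p => fderiv ℝ φ p (0, 1)

/-- The Laplacian in the plane. -/
def planeLaplacian (φ : ℝ × ℝ → ℝ) : ℝ × ℝ → ℝ :=
  fun p => partialX (partialX φ) p + partialY (partialY φ) p

/-- Smooth functions on the plane that are odd and `2L`-periodic in `x`, odd and `2H`-periodic
in `y`.  Restriction to `[0,L] × [0,H]` identifies them with the functions that are smooth up to
the boundary of the plate and vanish there together with all iterated Laplacians; in particular
every smooth function with compact support in the open plate occurs. -/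
structure IsDirichletTest (L H : ℝ) (φ : ℝ × ℝ → ℝ) : Prop where
  smooth : ContDiff ℝ ∞ φ
  odd_x : ∀ x y, φ (-x, y) = -φ (x, y)
  odd_y : ∀ x y, φ (x, -y) = -φ (x, y)
  periodic_x : ∀ x y, φ (x + 2 * L, y) = φ (x, y)
  periodic_y : ∀ x y, φ (x, y + 2 * H) = φ (x, y)

/-- The space of test functions. -/
def DirichletTest (L H : ℝ) : Submodule ℝ (ℝ × ℝ → ℝ) where
  carrier := {φ | IsDirichletTest L H φ}
  zero_mem' := by
    refine ⟨contDiff_const, ?_, ?_, ?_, ?_⟩ <;> intro x y <;> simp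
  add_mem' := by
    intro φ ψ hφ hψ
    refine ⟨hφ.smooth.add hψ.smooth, ?_, ?_, ?_, ?_⟩ <;> intro x y <;> simp only [Pi.add_apply]
    · rw [hφ.odd_x, hψ.odd_x]; ring
    · rw [hφ.odd_y, hψ.odd_y]; ring
    · rw [hφ.periodic_x, hψ.periodic_x]
    · rw [hφ.periodic_y, hψ.periodic_y]
  smul_mem' := by
    intro c φ hφ
    refine ⟨hφ.smooth.const_smul c, ?_, ?_, ?_, ?_⟩ <;> intro x y <;>
      simp only [Pi.smul_apply, smul_eq_mul]
    · rw [hφ.odd_x]; ring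
    · rw [hφ.odd_y]; ring
    · rw [hφ.periodic_x]
    · rw [hφ.periodic_y]

theorem partialX_smooth {φ : ℝ × ℝ → ℝ} (h : ContDiff ℝ ∞ φ) : ContDiff ℝ ∞ (partialX φ) :=
  (h.fderiv_right (m := ∞) (by simp)).clm_apply contDiff_const

theorem partialY_smooth {φ : ℝ × ℝ → ℝ} (h : ContDiff ℝ ∞ φ) : ContDiff ℝ ∞ (partialY φ) :=
  (h.fderiv_right (m := ∞) (by simp)).clm_apply contDiff_const

theorem partialX_eq_deriv {φ : ℝ × ℝ → ℝ} (h : ContDiff ℝ ∞ φ) (x y : ℝ) :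
    partialX φ (x, y) = deriv (fun s => φ (s, y)) x := by
  have h1 : HasFDerivAt φ (fderiv ℝ φ (x, y)) (x, y) :=
    (h.differentiable (by simp) (x, y)).hasFDerivAt
  have h2 : HasDerivAt (fun s : ℝ => (s, y)) ((1 : ℝ), (0 : ℝ)) x :=
    (hasDerivAt_id x).prodMk (hasDerivAt_const x y)
  exact (h1.comp_hasDerivAt x h2).deriv.symm

theorem partialY_eq_deriv {φ : ℝ × ℝ → ℝ} (h : ContDiff ℝ ∞ φ) (x y : ℝ) :
    partialY φ (x, y) = deriv (fun s => φ (x, s)) y := by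
  have h1 : HasFDerivAt φ (fderiv ℝ φ (x, y)) (x, y) :=
    (h.differentiable (by simp) (x, y)).hasFDerivAt
  have h2 : HasDerivAt (fun s : ℝ => (x, s)) ((0 : ℝ), (1 : ℝ)) y :=
    (hasDerivAt_const y x).prodMk (hasDerivAt_id y)
  exact (h1.comp_hasDerivAt y h2).deriv.symm

theorem partialX_reflect_x {φ : ℝ × ℝ → ℝ} (h : ContDiff ℝ ∞ φ) {c : ℝ}
    (hc : ∀ x y, φ (-x, y) = c * φ (x, y)) (x y : ℝ) :
    partialX φ (-x, y) = -c * partialX φ (x, y) := by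
  rw [partialX_eq_deriv h, partialX_eq_deriv h]
  have e : (fun s => φ (-s, y)) = fun s => c * φ (s, y) := funext fun s => hc s y
  have h1 := deriv_comp_neg (fun s => φ (s, y)) x
  have h2 : deriv (fun s => c * φ (s, y)) x = c * deriv (fun s => φ (s, y)) x := by
    simp
  rw [e, h2] at h1
  linarith

theorem partialY_reflect_y {φ : ℝ × ℝ → ℝ} (h : ContDiff ℝ ∞ φ) {c : ℝ}
    (hc : ∀ x y, φ (x, -y) = c * φ (x, y)) (x y : ℝ) :
    partialY φ (x, -y) = -c * partialY φ (x, y) := by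
  rw [partialY_eq_deriv h, partialY_eq_deriv h]
  have e : (fun s => φ (x, -s)) = fun s => c * φ (x, s) := funext fun s => hc x s
  have h1 := deriv_comp_neg (fun s => φ (x, s)) y
  have h2 : deriv (fun s => c * φ (x, s)) y = c * deriv (fun s => φ (x, s)) y := by
    simp
  rw [e, h2] at h1
  linarith

theorem partialX_reflect_y {φ : ℝ × ℝ → ℝ} (h : ContDiff ℝ ∞ φ)
    (hc : ∀ x y, φ (x, -y) = -φ (x, y)) (x y : ℝ) :
    partialX φ (x, -y) = -partialX φ (x, y) := by
  rw [partialX_eq_deriv h, partialX_eq_deriv h]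
  simp [hc]

theorem partialY_reflect_x {φ : ℝ × ℝ → ℝ} (h : ContDiff ℝ ∞ φ)
    (hc : ∀ x y, φ (-x, y) = -φ (x, y)) (x y : ℝ) :
    partialY φ (-x, y) = -partialY φ (x, y) := by
  rw [partialY_eq_deriv h, partialY_eq_deriv h]
  simp [hc]

theorem partialX_translate {φ : ℝ × ℝ → ℝ} (h : ContDiff ℝ ∞ φ) {a b : ℝ}
    (hc : ∀ x y, φ (x + a, y + b) = φ (x, y)) (x y : ℝ) :
    partialX φ (x + a, y + b) = partialX φ (x, y) := by
  rw [partialX_eq_deriv h, partialX_eq_deriv h]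
  have h1 := deriv_comp_add_const (fun s => φ (s, y + b)) a x
  simpa [hc] using h1.symm

theorem partialY_translate {φ : ℝ × ℝ → ℝ} (h : ContDiff ℝ ∞ φ) {a b : ℝ}
    (hc : ∀ x y, φ (x + a, y + b) = φ (x, y)) (x y : ℝ) :
    partialY φ (x + a, y + b) = partialY φ (x, y) := by
  rw [partialY_eq_deriv h, partialY_eq_deriv h]
  have h1 := deriv_comp_add_const (fun s => φ (x + a, s)) b y
  simpa [hc] using h1.symm

theorem planeLaplacian_translate {φ : ℝ × ℝ → ℝ} (h : ContDiff ℝ ∞ φ) {a b : ℝ}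
    (hc : ∀ x y, φ (x + a, y + b) = φ (x, y)) (x y : ℝ) :
    planeLaplacian φ (x + a, y + b) = planeLaplacian φ (x, y) := by
  simp only [planeLaplacian]
  rw [partialX_translate (partialX_smooth h) (partialX_translate h hc),
    partialY_translate (partialY_smooth h) (partialY_translate h hc)]

theorem planeLaplacian_isDirichletTest {L H : ℝ} {φ : ℝ × ℝ → ℝ} (h : IsDirichletTest L H φ) :
    IsDirichletTest L H (planeLaplacian φ) where
  smooth := (partialX_smooth (partialX_smooth h.smooth)).add
    (partialY_smooth (partialY_smooth h.smooth))
  odd_x := by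
    intro x y
    simp only [planeLaplacian]
    have hX := partialX_reflect_x h.smooth (c := -1) (fun x y => by rw [h.odd_x]; ring)
    rw [partialX_reflect_x (partialX_smooth h.smooth) hX,
      partialY_reflect_x (partialY_smooth h.smooth) (partialY_reflect_x h.smooth h.odd_x)]
    ring
  odd_y := by
    intro x y
    simp only [planeLaplacian]
    have hY := partialY_reflect_y h.smooth (c := -1) (fun x y => by rw [h.odd_y]; ring)
    rw [partialY_reflect_y (partialY_smooth h.smooth) hY,
      partialX_reflect_y (partialX_smooth h.smooth) (partialX_reflect_y h.smooth h.odd_y)]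
    ring
  periodic_x := by
    intro x y
    have := planeLaplacian_translate h.smooth (a := 2 * L) (b := 0)
      (fun x y => by rw [add_zero, h.periodic_x]) x y
    rwa [add_zero] at this
  periodic_y := by
    intro x y
    have := planeLaplacian_translate h.smooth (a := 0) (b := 2 * H)
      (fun x y => by rw [add_zero, h.periodic_y]) x y
    rwa [add_zero] at this

/-- The Laplacian of a test function, as a test function. -/
def testLaplacian {L H : ℝ} (φ : DirichletTest L H) : DirichletTest L H :=
  ⟨planeLaplacian φ, planeLaplacian_isDirichletTest φ.2⟩

/-- Distributions on the plate: linear functionals on the test space that are continuous for the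
topology of uniform convergence of all derivatives. -/
structure DirichletDistribution (L H : ℝ) where
  toLinearMap : DirichletTest L H →ₗ[ℝ] ℝ
  continuous' : ∃ (C : ℝ) (N : ℕ), ∀ (φ : DirichletTest L H) (M : ℝ),
    (∀ i j : ℕ, i ≤ N → j ≤ N → ∀ p, |partialX^[i] (partialY^[j] (φ : ℝ × ℝ → ℝ)) p| ≤ M) →
      |toLinearMap φ| ≤ C * M

instance (L H : ℝ) : CoeFun (DirichletDistribution L H) (fun _ => DirichletTest L H → ℝ) :=
  ⟨fun T => T.toLinearMap⟩

/-- The point mass `Θ δ(x - a) δ(y - b)`. -/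
def pointSource (L H Θ a b : ℝ) : DirichletDistribution L H where
  toLinearMap :=
    { toFun := fun φ => Θ * (φ : ℝ × ℝ → ℝ) (a, b)
      map_add' := by intro φ ψ; simp [mul_add]
      map_smul' := by intro c φ; simp; ring }
  continuous' := by
    refine ⟨|Θ|, 0, fun φ M hM => ?_⟩
    have h := hM 0 0 le_rfl le_rfl (a, b)
    simp only [Function.iterate_zero, id_eq] at h
    change |Θ * (φ : ℝ × ℝ → ℝ) (a, b)| ≤ _
    rw [abs_mul]
    exact mul_le_mul_of_nonneg_left h (abs_nonneg _)

/-! ### The elliptical trajectory and the moving source -/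

/-- First coordinate of the source. -/
def xBar (L A w : ℝ) (t : ℝ) : ℝ := L / 2 + A * Real.cos (w * t)

/-- Second coordinate of the source. -/
def yBar (H B w : ℝ) (t : ℝ) : ℝ := H / 2 + B * Real.sin (w * t)

/-- The heat source `Q(t) = Θ δ(x - x̄(t)) δ(y - ȳ(t))`. -/
def heatSource (L H Θ A B w : ℝ) (t : ℝ) : DirichletDistribution L H :=
  pointSource L H Θ (xBar L A w t) (yBar H B w t)

/-! ### The initial-boundary value problems

All derivatives in time are taken weakly (after pairing with a test function), one-sided at
`t = 0`.  The Laplacian acts on a distribution by transposition; since test functions vanish on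
the boundary of the plate while their normal derivatives are free there, the absence of boundary
terms in the equation is the homogeneous Dirichlet condition. -/

/-- `T` solves
`ΔT + τT ∂ₜΔT + (1/k)(Q + τq ∂ₜQ) = (1/α)(∂ₜT + τq ∂ₜ²T)` for `t ≥ 0`,
with zero Dirichlet data and `T(0) = ∂ₜT(0) = 0`. -/
structure IsDPLSolution (L H α k τq τT Θ A B w : ℝ) (T : ℝ → DirichletDistribution L H) :
    Prop where
  contDiffOn : ∀ φ, ContDiffOn ℝ 2 (fun t => T t φ) (Set.Ici 0)
  equation : ∀ φ, ∀ t, 0 ≤ t →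
    T t (testLaplacian φ)
      + τT * derivWithin (fun s => T s (testLaplacian φ)) (Set.Ici 0) t
      + 1 / k * (heatSource L H Θ A B w t φ
          + τq * deriv (fun s => heatSource L H Θ A B w s φ) t)
    = 1 / α * (derivWithin (fun s => T s φ) (Set.Ici 0) t
        + τq * iteratedDerivWithin 2 (fun s => T s φ) (Set.Ici 0) t)
  initial : ∀ φ, T 0 φ = 0
  initial_deriv : ∀ φ, derivWithin (fun s => T s φ) (Set.Ici 0) 0 = 0

/-- `T` solves the classical heat equation `ΔT + (1/k) Q = (1/α) ∂ₜT` for `t ≥ 0`, with zero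
Dirichlet data and `T(0) = 0`. -/
structure IsHeatSolution (L H α k Θ A B w : ℝ) (T : ℝ → DirichletDistribution L H) :
    Prop where
  contDiffOn : ∀ φ, ContDiffOn ℝ 1 (fun t => T t φ) (Set.Ici 0)
  equation : ∀ φ, ∀ t, 0 ≤ t →
    T t (testLaplacian φ) + 1 / k * heatSource L H Θ A B w t φ
    = 1 / α * derivWithin (fun s => T s φ) (Set.Ici 0) t
  initial : ∀ φ, T 0 φ = 0

/-! ### The series -/

/-- `μₘ = mπ/L` (and `γₙ = nπ/H`). -/
def freq (L : ℝ) (m : ℕ) : ℝ := m * Real.pi / L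

/-- `λₘₙ² = μₘ² + γₙ²`. -/
def lambdaSq (L H : ℝ) (m n : ℕ) : ℝ := freq L m ^ 2 + freq H n ^ 2

/-- `sin(μₘ x) sin(γₙ y)`. -/
def sineMode (L H : ℝ) (m n : ℕ) (p : ℝ × ℝ) : ℝ :=
  Real.sin (freq L m * p.1) * Real.sin (freq H n * p.2)

def beta1 (L H α τq τT : ℝ) (m n : ℕ) : ℝ :=
  (1 + α * τT * lambdaSq L H m n) / (2 * τq)

/-- The square root is complex: the radicand may be negative.  The coefficients below are even
in `β₂`, so that the choice of the branch is irrelevant. -/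
def beta2 (L H α τq τT : ℝ) (m n : ℕ) : ℂ :=
  (((1 + α * τT * lambdaSq L H m n) ^ 2 - 4 * α * τq * lambdaSq L H m n : ℝ) : ℂ)
    ^ (1 / 2 : ℂ) / (2 * (τq : ℂ))

/-- The factor of the integrand of `Pₘₙ` that comes from the trajectory. -/
def sourceFactor (L H τq A B w : ℝ) (m n : ℕ) (τ : ℝ) : ℝ :=
  Real.sin (freq L m * xBar L A w τ) * Real.sin (freq H n * yBar H B w τ)
    + τq * freq L m * deriv (xBar L A w) τ
        * Real.cos (freq L m * xBar L A w τ) * Real.sin (freq H n * yBar H B w τ)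
    + τq * freq H n * deriv (yBar H B w) τ
        * Real.sin (freq L m * xBar L A w τ) * Real.cos (freq H n * yBar H B w τ)

/-- `Pₘₙ(t)`. -/
def dplP (L H α τq τT A B w : ℝ) (m n : ℕ) (t : ℝ) : ℂ :=
  ∫ τ in (0 : ℝ)..t, (sourceFactor L H τq A B w m n τ : ℂ)
    * Complex.exp (-(beta1 L H α τq τT m n : ℂ) * (t - τ))
    * Complex.sinh (beta2 L H α τq τT m n * (t - τ))

/-- The coefficient `4αΘ / (L H τq β₂ k) · Pₘₙ(t)`.  In the degenerate case `β₂ = 0` it is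
replaced by its limit as `β₂ → 0`, in which `sinh(β₂ s)/β₂` becomes `s`. -/
def dplCoeff (L H α k τq τT Θ A B w : ℝ) (m n : ℕ) (t : ℝ) : ℂ :=
  if beta2 L H α τq τT m n = 0 then
    4 * α * Θ / (L * H * τq * k)
      * ∫ τ in (0 : ℝ)..t, (sourceFactor L H τq A B w m n τ : ℂ)
          * Complex.exp (-(beta1 L H α τq τT m n : ℂ) * (t - τ)) * (t - τ)
  else
    4 * α * Θ / (L * H * τq * beta2 L H α τq τT m n * k) * dplP L H α τq τT A B w m n t

/-- `Pₘₙ(t)` of the classical heat equation. -/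
def heatP (L H α A B w : ℝ) (m n : ℕ) (t : ℝ) : ℝ :=
  ∫ τ in (0 : ℝ)..t, Real.exp (-α * lambdaSq L H m n * (t - τ))
    * Real.sin (freq L m * xBar L A w τ) * Real.sin (freq H n * yBar H B w τ)

/-- The coefficient `4αΘ / (L H k) · Pₘₙ(t)` of the classical heat equation. -/
def heatCoeff (L H α k Θ A B w : ℝ) (m n : ℕ) (t : ℝ) : ℝ :=
  4 * α * Θ / (L * H * k) * heatP L H α A B w m n t

/-- The plate `[0,L] × [0,H]`. -/
def plate (L H : ℝ) : Set (ℝ × ℝ) := Set.Icc 0 L ×ˢ Set.Icc 0 H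

/-- `T = ∑_{m,n ≥ 1} c m n · sin(μₘ x) sin(γₙ y)` with (unconditional) convergence in the sense
of distributions. -/
def IsDistribSineSeries (L H : ℝ) (c : ℕ → ℕ → ℂ) (T : DirichletDistribution L H) : Prop :=
  ∀ φ : DirichletTest L H,
    HasSum (fun q : ℕ × ℕ => c (q.1 + 1) (q.2 + 1)
        * ((∫ p in plate L H, sineMode L H (q.1 + 1) (q.2 + 1) p * (φ : ℝ × ℝ → ℝ) p : ℝ) : ℂ))
      ((T φ : ℝ) : ℂ)

/-- `T` is the square-integrable function `θ` on the plate, and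
`θ = ∑_{m,n ≥ 1} c m n · sin(μₘ x) sin(γₙ y)` with (unconditional) convergence in `L²`. -/
def IsL2SineSeries (L H : ℝ) (c : ℕ → ℕ → ℂ) (T : DirichletDistribution L H)
    (θ : ℝ × ℝ → ℝ) : Prop :=
  MemLp θ 2 (volume.restrict (plate L H)) ∧
  (∀ φ : DirichletTest L H, T φ = ∫ p in plate L H, θ p * (φ : ℝ × ℝ → ℝ) p) ∧
  Tendsto (fun F : Finset (ℕ × ℕ) =>
      eLpNorm (fun p => (θ p : ℂ)
          - ∑ q ∈ F, c (q.1 + 1) (q.2 + 1) * (sineMode L H (q.1 + 1) (q.2 + 1) p : ℂ))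
        2 (volume.restrict (plate L H)))
    atTop (𝓝 0)

end

open MeasureTheory Filter Topology
open scoped ContDiff

noncomputable section

/-! ### Sine series in one variable -/

/-! The sine modes are eigenfunctions of the Dirichlet Laplacian, so the problem splits into one
scalar ODE per mode. Two facts about the test space justify this. Integrating by parts twice against
a sine produces the factor -μ² and no boundary terms, so a test function has rapidly decreasing sine
coefficients (`summable_sineCoeff`) and equals its sine series together with all derivatives. Hence
a distribution is recovered from its values on the modes (`DirichletDistribution.hasSum_sineCoeff`),
and conversely coefficients of polynomial growth define a distribution (`exists_distribution`).

Pairing the dual-phase-lag equation with a mode gives a'' + b a' + c a = κ (s + τq s') with b = (1 +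
α τT λ²)/τq and c = α λ²/τq, where s is the value of the mode at the source. The coefficients in the
theorem solve this with zero initial data, by variation of constants (`exists_dplMode`). That
solution is unique (`damped_unique`), so every solution of the problem has the asserted series.

For the converse the series must be differentiated term by term, which needs bounds on a, a', a''
that are polynomial in the mode and locally uniform in time. They come from an energy estimate
(`energy_le`) for the shifted momentum v = a' + b a - κ τq s. Its derivative κ s - c a no longer
contains s', and the resulting constants depend on the mode through c/b only (`damped_bounds`).

The bound for a carries an extra factor 1/b. If τT > 0, then c/b ≤ 1/τT and 1/b = O(1/λ²) =
O(1/(mn)), so the coefficients are square-summable; orthogonality of the modes then gives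
convergence in L² (`exists_isL2SineSeries`). The heat equation follows the same scheme with a' = κ s
- α λ² a, whose solution is O(1/λ²) by `abs_le_of_damped`. -/

theorem integral_symmetric_interval {h : ℝ → ℂ} (hh : Continuous h) (L : ℝ) :
    ∫ x in (-L)..L, h x = ∫ x in (0 : ℝ)..L, (h x + h (-x)) := by
  have hn : Continuous fun x => h (-x) := by fun_prop
  rw [intervalIntegral.integral_add (hh.intervalIntegrable _ _)
    (hn.intervalIntegrable _ _),
    intervalIntegral.integral_comp_neg (fun x => h x), neg_zero, add_comm]
  exact (intervalIntegral.integral_add_adjacent_intervals (hh.intervalIntegrable _ _)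
    (hh.intervalIntegrable _ _)).symm

/-- Folding [-L, L] onto [0, L] pairs x with -x. For odd f the two exponentials combine to -2i sin,
and the normalisation 1/(2L) leaves the factor -i/L. -/
theorem fourierCoeff_odd {L : ℝ} [Fact (0 < 2 * L)] {f : ℝ → ℝ} (hf : Continuous f)
    (hodd : ∀ x, f (-x) = -f x) (g : AddCircle (2 * L) → ℂ) (hg : ∀ x : ℝ, g x = f x) (n : ℤ) :
    fourierCoeff g n = -(Complex.I / L)
      * ((∫ u in (0 : ℝ)..L, Real.sin (n * Real.pi / L * u) * f u : ℝ) : ℂ) := by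
  have hL : L ≠ 0 := by
    have h := (Fact.out : 0 < 2 * L)
    intro h0
    simp [h0] at h
  have hLc : (L : ℂ) ≠ 0 := by exact_mod_cast hL
  rw [fourierCoeff_eq_intervalIntegral g n (-L), show -L + 2 * L = L by ring]
  have e : ∀ x : ℝ, @fourier (2 * L) (-n) x • g x
      = Complex.exp (-((n * Real.pi / L * x : ℝ) : ℂ) * Complex.I) * f x := by
    intro x
    rw [hg, fourier_coe_apply, smul_eq_mul]
    congr 2
    push_cast
    field_simp
  simp_rw [e]
  rw [integral_symmetric_interval (by fun_prop), ← intervalIntegral.integral_ofReal,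
    ← intervalIntegral.integral_const_mul, ← intervalIntegral.integral_smul]
  refine intervalIntegral.integral_congr fun x _ => ?_
  simp only [hodd, Complex.real_smul, Complex.ofReal_neg, mul_neg, neg_mul, Complex.ofReal_mul,
    Complex.ofReal_sin]
  have h := Complex.two_sin (((n * Real.pi / L : ℝ) : ℂ) * x)
  simp only [neg_mul, neg_neg] at h ⊢
  have hI : Complex.I * Complex.I = -1 := Complex.I_mul_I
  generalize Complex.exp (-(((n * Real.pi / L : ℝ) : ℂ) * x * Complex.I)) = E1 at *
  generalize Complex.exp (((n * Real.pi / L : ℝ) : ℂ) * x * Complex.I) = E2 at *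
  have h2 : Complex.sin (((n * Real.pi / L : ℝ) : ℂ) * x) = (E1 - E2) * Complex.I / 2 := by
    rw [← h]; ring
  rw [h2]
  push_cast
  field_simp
  linear_combination ((f x : ℂ) * E1 - f x * E2) * hI

/-- The Fourier series of f on the circle of length 2L converges pointwise because its coefficients
are summable. The coefficients at n and -n are opposite, so the two exponentials merge into one
sine. -/
theorem hasSum_sine_series {L : ℝ} (hL : 0 < L) {f : ℝ → ℝ} (hf : Continuous f)
    (hodd : ∀ x, f (-x) = -f x) (hper : ∀ x, f (x + 2 * L) = f x)
    (hs : Summable fun m : ℕ => ∫ u in (0 : ℝ)..L, Real.sin (freq L (m + 1) * u) * f u) (x : ℝ) :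
    HasSum (fun m : ℕ => 2 / L * (∫ u in (0 : ℝ)..L, Real.sin (freq L (m + 1) * u) * f u)
      * Real.sin (freq L (m + 1) * x)) (f x) := by
  have : Fact (0 < 2 * L) := ⟨by linarith⟩
  have hLc : (L : ℂ) ≠ 0 := by exact_mod_cast hL.ne'
  have hp : Function.Periodic (fun x => (f x : ℂ)) (2 * L) := fun x => by simp only [hper]
  let g : C(AddCircle (2 * L), ℂ) := ⟨hp.lift, by
    refine continuous_coinduced_dom.mpr ?_
    exact Complex.continuous_ofReal.comp hf⟩
  have hg : ∀ x : ℝ, g x = f x := fun x => hp.lift_coe x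
  have hc := fourierCoeff_odd hf hodd g hg
  set B : ℤ → ℝ := fun n => ∫ u in (0 : ℝ)..L, Real.sin (n * Real.pi / L * u) * f u with hB
  have hBneg : ∀ n, B (-n) = -B n := by
    intro n
    simp only [hB, Int.cast_neg, neg_mul, neg_div, Real.sin_neg, intervalIntegral.integral_neg]
  have hB0 : B 0 = 0 := by simp [hB]
  have hBs : Summable fun m : ℕ => B m := by
    rw [← summable_nat_add_iff 1]
    simpa [hB, freq] using hs
  have hsum : Summable (fourierCoeff g) := by
    have h1 : Summable B := by
      refine Summable.of_nat_of_neg hBs ?_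
      simpa [hBneg] using hBs.neg
    have h2 : fourierCoeff g = fun n => -(Complex.I / L) * (B n : ℂ) := funext hc
    rw [h2]
    exact ((Complex.hasSum_ofReal.2 h1.hasSum).summable).mul_left _
  have h := has_pointwise_sum_fourier_series_of_summable hsum (x : AddCircle (2 * L))
  -- Pairing n with -n counts the index 0 twice; this is harmless because the zeroth coefficient of
  -- an odd function vanishes.
  have h1 := h.nat_add_neg
  have hz : fourierCoeff g 0 = 0 := by rw [hc]; simp
  have h2 := (hasSum_nat_add_iff' 1).2 h1
  simp only [Finset.range_one, Finset.sum_singleton, Nat.cast_zero, neg_zero, hz, zero_smul,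
    add_zero, sub_zero, hg] at h2
  rw [← Complex.hasSum_ofReal]
  refine (congrArg (fun F => HasSum F (f x : ℂ)) (funext fun m => ?_)).mpr h2
  rw [hc, hc]
  change _ = (-(Complex.I / L) * (B ((m + 1 : ℕ) : ℤ) : ℂ)) • _
    + (-(Complex.I / L) * (B (-((m + 1 : ℕ) : ℤ)) : ℂ)) • _
  rw [hBneg]
  have e1 : (∫ u in (0 : ℝ)..L, Real.sin (freq L (m + 1) * u) * f u) = B ((m + 1 : ℕ) : ℤ) := by
    simp [hB, freq]
  rw [e1, fourier_coe_apply, fourier_coe_apply, smul_eq_mul, smul_eq_mul]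
  have hsin := Complex.two_sin (((freq L (m + 1) * x : ℝ) : ℂ))
  have a1 : (2 * Real.pi * Complex.I * (((m + 1 : ℕ) : ℤ) : ℂ) * x / ((2 * L : ℝ) : ℂ))
      = ((freq L (m + 1) * x : ℝ) : ℂ) * Complex.I := by
    simp only [freq]; push_cast; field_simp
  have a2 : (2 * Real.pi * Complex.I * ((-((m + 1 : ℕ) : ℤ) : ℤ) : ℂ) * x / ((2 * L : ℝ) : ℂ))
      = -((freq L (m + 1) * x : ℝ) : ℂ) * Complex.I := by
    simp only [freq]; push_cast; field_simp
  rw [a1, a2]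
  generalize Complex.exp (((freq L (m + 1) * x : ℝ) : ℂ) * Complex.I) = E1 at *
  generalize Complex.exp (-((freq L (m + 1) * x : ℝ) : ℂ) * Complex.I) = E2 at *
  simp only [Complex.ofReal_mul (_ * _), Complex.ofReal_mul (2 / L), Complex.ofReal_sin]
  have h2 : Complex.sin ((freq L (m + 1) * x : ℝ) : ℂ) = (E2 - E1) * Complex.I / 2 := by
    rw [← hsin]; ring
  rw [h2]
  push_cast
  field_simp
  ring

theorem freq_pos {L : ℝ} (hL : 0 < L) (m : ℕ) : 0 < freq L (m + 1) := by
  unfold freq; push_cast; positivity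

theorem sin_freq_mul_length {L : ℝ} (hL : 0 < L) (m : ℕ) : Real.sin (freq L m * L) = 0 := by
  rw [show freq L m * L = m * Real.pi by unfold freq; field_simp]
  exact Real.sin_nat_mul_pi m

theorem odd_zero {f : ℝ → ℝ} (hodd : ∀ x, f (-x) = -f x) : f 0 = 0 := by
  have := hodd 0
  rw [neg_zero] at this
  linarith

theorem odd_periodic_half {f : ℝ → ℝ} {L : ℝ} (hodd : ∀ x, f (-x) = -f x)
    (hper : ∀ x, f (x + 2 * L) = f x) : f L = 0 := by
  have h1 := hper (-L)
  rw [hodd, show -L + 2 * L = L by ring] at h1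
  linarith

/-- Integration by parts against a sine. -/
theorem integral_sin_mul_deriv_deriv {L : ℝ} (hL : 0 < L) {f f' f'' : ℝ → ℝ}
    (hf' : ∀ x, HasDerivAt f (f' x) x) (hf'' : ∀ x, HasDerivAt f' (f'' x) x) (hc : Continuous f'')
    (hodd : ∀ x, f (-x) = -f x) (hper : ∀ x, f (x + 2 * L) = f x) (m : ℕ) :
    ∫ u in (0 : ℝ)..L, Real.sin (freq L m * u) * f'' u
      = -(freq L m) ^ 2 * ∫ u in (0 : ℝ)..L, Real.sin (freq L m * u) * f u := by
  have cf : Continuous f := continuous_iff_continuousAt.2 fun x => (hf' x).continuousAt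
  have cf' : Continuous f' := continuous_iff_continuousAt.2 fun x => (hf'' x).continuousAt
  set μ := freq L m
  have hs : ∀ x, HasDerivAt (fun u => Real.sin (μ * u)) (μ * Real.cos (μ * x)) x := fun x => by
    have := ((hasDerivAt_id x).const_mul μ).sin
    simpa [mul_comm] using this
  have hco : ∀ x, HasDerivAt (fun u => μ * Real.cos (μ * u)) (-μ ^ 2 * Real.sin (μ * x)) x :=
    fun x => by
      have := (((hasDerivAt_id x).const_mul μ).cos).const_mul μ
      exact this.congr_deriv (by simp only [id]; ring)
  have key : ∀ x, HasDerivAt (fun u => Real.sin (μ * u) * f' u - μ * Real.cos (μ * u) * f u)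
      (Real.sin (μ * x) * f'' x + μ ^ 2 * (Real.sin (μ * x) * f x)) x := fun x => by
    exact (((hs x).mul (hf'' x)).sub ((hco x).mul (hf' x))).congr_deriv (by ring)
  have hint := intervalIntegral.integral_eq_sub_of_hasDerivAt (a := 0) (b := L) (fun x _ => key x)
    (Continuous.intervalIntegrable (by fun_prop) _ _)
  -- Both boundary terms vanish: the one with f' because sin(μ u) is zero at 0 and L, the one with f
  -- because oddness and periodicity force f(0) = f(L) = 0.
  rw [intervalIntegral.integral_add (Continuous.intervalIntegrable (by fun_prop) _ _)
    (Continuous.intervalIntegrable (by fun_prop) _ _), intervalIntegral.integral_const_mul,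
    sin_freq_mul_length hL, odd_zero hodd, odd_periodic_half hodd hper] at hint
  simp only [mul_zero, Real.sin_zero, zero_mul, sub_zero] at hint
  linarith

/-! ### Test functions and their sine coefficients -/

theorem hasDerivAt_partialX {φ : ℝ × ℝ → ℝ} (h : ContDiff ℝ ∞ φ) (x y : ℝ) :
    HasDerivAt (fun s => φ (s, y)) (partialX φ (x, y)) x := by
  have h2 : HasDerivAt (fun s : ℝ => (s, y)) ((1 : ℝ), (0 : ℝ)) x :=
    (hasDerivAt_id x).prodMk (hasDerivAt_const x y)
  exact (h.differentiable (by simp) (x, y)).hasFDerivAt.comp_hasDerivAt x h2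

theorem hasDerivAt_partialY {φ : ℝ × ℝ → ℝ} (h : ContDiff ℝ ∞ φ) (x y : ℝ) :
    HasDerivAt (fun s => φ (x, s)) (partialY φ (x, y)) y := by
  have h2 : HasDerivAt (fun s : ℝ => (x, s)) ((0 : ℝ), (1 : ℝ)) y :=
    (hasDerivAt_const y x).prodMk (hasDerivAt_id y)
  exact (h.differentiable (by simp) (x, y)).hasFDerivAt.comp_hasDerivAt y h2

theorem partialX_iterate_smooth {φ : ℝ × ℝ → ℝ} (h : ContDiff ℝ ∞ φ) (i : ℕ) :
    ContDiff ℝ ∞ (partialX^[i] φ) := by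
  induction i with
  | zero => exact h
  | succ i ih => rw [Function.iterate_succ_apply']; exact partialX_smooth ih

theorem partialY_iterate_smooth {φ : ℝ × ℝ → ℝ} (h : ContDiff ℝ ∞ φ) (i : ℕ) :
    ContDiff ℝ ∞ (partialY^[i] φ) := by
  induction i with
  | zero => exact h
  | succ i ih => rw [Function.iterate_succ_apply']; exact partialY_smooth ih

theorem IsDirichletTest.partialX_partialX {L H : ℝ} {φ : ℝ × ℝ → ℝ} (h : IsDirichletTest L H φ) :
    IsDirichletTest L H (partialX (partialX φ)) where
  smooth := partialX_smooth (partialX_smooth h.smooth)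
  odd_x x y := by
    have hX := partialX_reflect_x h.smooth (c := -1) (fun x y => by rw [h.odd_x]; ring)
    rw [partialX_reflect_x (partialX_smooth h.smooth) hX]; ring
  odd_y := partialX_reflect_y (partialX_smooth h.smooth) (partialX_reflect_y h.smooth h.odd_y)
  periodic_x x y := by
    have := partialX_translate (partialX_smooth h.smooth) (partialX_translate h.smooth
      (a := 2 * L) (b := 0) (fun x y => by rw [add_zero, h.periodic_x])) x y
    rwa [add_zero] at this
  periodic_y x y := by
    have := partialX_translate (partialX_smooth h.smooth) (partialX_translate h.smooth
      (a := 0) (b := 2 * H) (fun x y => by rw [add_zero, h.periodic_y])) x y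
    rwa [add_zero] at this

theorem IsDirichletTest.partialY_partialY {L H : ℝ} {φ : ℝ × ℝ → ℝ} (h : IsDirichletTest L H φ) :
    IsDirichletTest L H (partialY (partialY φ)) where
  smooth := partialY_smooth (partialY_smooth h.smooth)
  odd_y x y := by
    have hX := partialY_reflect_y h.smooth (c := -1) (fun x y => by rw [h.odd_y]; ring)
    rw [partialY_reflect_y (partialY_smooth h.smooth) hX]; ring
  odd_x := partialY_reflect_x (partialY_smooth h.smooth) (partialY_reflect_x h.smooth h.odd_x)
  periodic_x x y := by
    have := partialY_translate (partialY_smooth h.smooth) (partialY_translate h.smooth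
      (a := 2 * L) (b := 0) (fun x y => by rw [add_zero, h.periodic_x])) x y
    rwa [add_zero] at this
  periodic_y x y := by
    have := partialY_translate (partialY_smooth h.smooth) (partialY_translate h.smooth
      (a := 0) (b := 2 * H) (fun x y => by rw [add_zero, h.periodic_y])) x y
    rwa [add_zero] at this

theorem IsDirichletTest.iterate_partialX {L H : ℝ} {φ : ℝ × ℝ → ℝ} (h : IsDirichletTest L H φ)
    (i : ℕ) : IsDirichletTest L H (partialX^[2 * i] φ) := by
  induction i with
  | zero => exact h
  | succ i ih =>
    rw [show 2 * (i + 1) = 2 * i + 1 + 1 by ring, Function.iterate_succ_apply',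
      Function.iterate_succ_apply']
    exact ih.partialX_partialX

theorem IsDirichletTest.iterate_partialY {L H : ℝ} {φ : ℝ × ℝ → ℝ} (h : IsDirichletTest L H φ)
    (i : ℕ) : IsDirichletTest L H (partialY^[2 * i] φ) := by
  induction i with
  | zero => exact h
  | succ i ih =>
    rw [show 2 * (i + 1) = 2 * i + 1 + 1 by ring, Function.iterate_succ_apply',
      Function.iterate_succ_apply']
    exact ih.partialY_partialY

/-- The sine coefficient `∫∫ sin(μₘ₊₁ x) sin(γₙ₊₁ y) φ(x, y) dy dx`. -/
def sineCoeff (L H : ℝ) (q : ℕ × ℕ) (φ : ℝ × ℝ → ℝ) : ℝ :=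
  ∫ p in plate L H, sineMode L H (q.1 + 1) (q.2 + 1) p * φ p

theorem integrableOn_plate {L H : ℝ} {f : ℝ × ℝ → ℝ} (hf : Continuous f) :
    IntegrableOn f (plate L H) :=
  hf.continuousOn.integrableOn_compact (isCompact_Icc.prod isCompact_Icc)

theorem continuous_sineMode (L H : ℝ) (m n : ℕ) : Continuous (sineMode L H m n) := by
  unfold sineMode; fun_prop

theorem integral_plate {L H : ℝ} (hL : 0 < L) (hH : 0 < H) {f : ℝ × ℝ → ℝ} (hf : Continuous f) :
    ∫ p in plate L H, f p = ∫ x in (0 : ℝ)..L, ∫ y in (0 : ℝ)..H, f (x, y) := by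
  have h := setIntegral_prod (μ := volume) (ν := volume) f (s := Set.Icc 0 L) (t := Set.Icc 0 H)
    (integrableOn_plate hf)
  rw [intervalIntegral.integral_of_le hL.le, ← integral_Icc_eq_integral_Ioc]
  simp_rw [intervalIntegral.integral_of_le hH.le, ← integral_Icc_eq_integral_Ioc]
  exact h

theorem integral_plate_symm {L H : ℝ} (hL : 0 < L) (hH : 0 < H) {f : ℝ × ℝ → ℝ}
    (hf : Continuous f) :
    ∫ p in plate L H, f p = ∫ y in (0 : ℝ)..H, ∫ x in (0 : ℝ)..L, f (x, y) := by
  rw [← integral_plate (L := H) (H := L) hH hL (f := fun p => f (p.2, p.1)) (by fun_prop)]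
  exact (setIntegral_prod_swap (μ := volume) (ν := volume) (Set.Icc 0 L) (Set.Icc 0 H) f).symm

theorem sineCoeff_eq {L H : ℝ} (hL : 0 < L) (hH : 0 < H) {φ : ℝ × ℝ → ℝ} (hφ : Continuous φ)
    (q : ℕ × ℕ) : sineCoeff L H q φ = ∫ x in (0 : ℝ)..L, Real.sin (freq L (q.1 + 1) * x)
      * ∫ y in (0 : ℝ)..H, Real.sin (freq H (q.2 + 1) * y) * φ (x, y) := by
  rw [sineCoeff, integral_plate hL hH (f := fun p =>
    sineMode L H (q.1 + 1) (q.2 + 1) p * φ p) ((continuous_sineMode _ _ _ _).mul hφ)]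
  simp_rw [← intervalIntegral.integral_const_mul, sineMode, mul_assoc]

theorem sineCoeff_eq_symm {L H : ℝ} (hL : 0 < L) (hH : 0 < H) {φ : ℝ × ℝ → ℝ} (hφ : Continuous φ)
    (q : ℕ × ℕ) : sineCoeff L H q φ = ∫ y in (0 : ℝ)..H, Real.sin (freq H (q.2 + 1) * y)
      * ∫ x in (0 : ℝ)..L, Real.sin (freq L (q.1 + 1) * x) * φ (x, y) := by
  rw [sineCoeff, integral_plate_symm hL hH (f := fun p =>
    sineMode L H (q.1 + 1) (q.2 + 1) p * φ p) ((continuous_sineMode _ _ _ _).mul hφ)]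
  simp_rw [← intervalIntegral.integral_const_mul, sineMode]
  refine intervalIntegral.integral_congr fun y _ => intervalIntegral.integral_congr fun x _ => ?_
  ring

theorem sineCoeff_partialX_partialX {L H : ℝ} (hL : 0 < L) (hH : 0 < H) {φ : ℝ × ℝ → ℝ}
    (h : IsDirichletTest L H φ) (q : ℕ × ℕ) :
    sineCoeff L H q (partialX (partialX φ)) = -freq L (q.1 + 1) ^ 2 * sineCoeff L H q φ := by
  rw [sineCoeff_eq_symm hL hH h.partialX_partialX.smooth.continuous,
    sineCoeff_eq_symm hL hH h.smooth.continuous, ← intervalIntegral.integral_const_mul]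
  refine intervalIntegral.integral_congr fun y _ => ?_
  rw [integral_sin_mul_deriv_deriv hL (fun x => hasDerivAt_partialX h.smooth x y)
    (fun x => hasDerivAt_partialX (partialX_smooth h.smooth) x y)
    (h.partialX_partialX.smooth.continuous.comp (by fun_prop))
    (fun x => h.odd_x x y) (fun x => h.periodic_x x y)]
  ring

theorem sineCoeff_partialY_partialY {L H : ℝ} (hL : 0 < L) (hH : 0 < H) {φ : ℝ × ℝ → ℝ}
    (h : IsDirichletTest L H φ) (q : ℕ × ℕ) :
    sineCoeff L H q (partialY (partialY φ)) = -freq H (q.2 + 1) ^ 2 * sineCoeff L H q φ := by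
  rw [sineCoeff_eq hL hH h.partialY_partialY.smooth.continuous,
    sineCoeff_eq hL hH h.smooth.continuous, ← intervalIntegral.integral_const_mul]
  refine intervalIntegral.integral_congr fun x _ => ?_
  rw [integral_sin_mul_deriv_deriv hH (fun y => hasDerivAt_partialY h.smooth x y)
    (fun y => hasDerivAt_partialY (partialY_smooth h.smooth) x y)
    (h.partialY_partialY.smooth.continuous.comp (by fun_prop))
    (fun y => h.odd_y x y) (fun y => h.periodic_y x y)]
  ring

theorem sineCoeff_add {L H : ℝ} {φ ψ : ℝ × ℝ → ℝ} (hφ : Continuous φ) (hψ : Continuous ψ)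
    (q : ℕ × ℕ) : sineCoeff L H q (φ + ψ) = sineCoeff L H q φ + sineCoeff L H q ψ := by
  have hc := continuous_sineMode L H (q.1 + 1) (q.2 + 1)
  simp only [sineCoeff, Pi.add_apply, mul_add]
  exact integral_add (integrableOn_plate (hc.mul hφ)) (integrableOn_plate (hc.mul hψ))

theorem sineCoeff_smul (L H : ℝ) (c : ℝ) (φ : ℝ × ℝ → ℝ) (q : ℕ × ℕ) :
    sineCoeff L H q (c • φ) = c * sineCoeff L H q φ := by
  simp only [sineCoeff, Pi.smul_apply, smul_eq_mul]
  rw [← integral_const_mul]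
  congr 1
  ext p
  ring

theorem sineCoeff_planeLaplacian {L H : ℝ} (hL : 0 < L) (hH : 0 < H) {φ : ℝ × ℝ → ℝ}
    (h : IsDirichletTest L H φ) (q : ℕ × ℕ) :
    sineCoeff L H q (planeLaplacian φ)
      = -lambdaSq L H (q.1 + 1) (q.2 + 1) * sineCoeff L H q φ := by
  have := sineCoeff_add (L := L) (H := H) h.partialX_partialX.smooth.continuous
    h.partialY_partialY.smooth.continuous q
  rw [sineCoeff_partialX_partialX hL hH h, sineCoeff_partialY_partialY hL hH h] at this
  rw [show planeLaplacian φ = partialX (partialX φ) + partialY (partialY φ) from rfl, this,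
    lambdaSq]
  ring

theorem sineCoeff_iterate {L H : ℝ} (hL : 0 < L) (hH : 0 < H) {φ : ℝ × ℝ → ℝ}
    (h : IsDirichletTest L H φ) (q : ℕ × ℕ) (i j : ℕ) :
    sineCoeff L H q (partialX^[2 * i] (partialY^[2 * j] φ))
      = (-freq L (q.1 + 1) ^ 2) ^ i * (-freq H (q.2 + 1) ^ 2) ^ j * sineCoeff L H q φ := by
  induction i with
  | zero =>
    induction j with
    | zero => simp
    | succ j ih =>
      simp only [mul_zero, Function.iterate_zero, id] at ih ⊢
      rw [show 2 * (j + 1) = 2 * j + 1 + 1 by ring, Function.iterate_succ_apply',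
        Function.iterate_succ_apply', sineCoeff_partialY_partialY hL hH (h.iterate_partialY j), ih]
      ring
  | succ i ih =>
    rw [show 2 * (i + 1) = 2 * i + 1 + 1 by ring, Function.iterate_succ_apply',
      Function.iterate_succ_apply',
      sineCoeff_partialX_partialX hL hH ((h.iterate_partialY j).iterate_partialX i), ih]
    ring

theorem abs_sineMode_le (L H : ℝ) (m n : ℕ) (p : ℝ × ℝ) : |sineMode L H m n p| ≤ 1 := by
  rw [sineMode, abs_mul]
  exact mul_le_one₀ (Real.abs_sin_le_one _) (abs_nonneg _) (Real.abs_sin_le_one _)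

theorem abs_sineCoeff_le {L H : ℝ} (hL : 0 < L) (hH : 0 < H) {φ : ℝ × ℝ → ℝ}
    (q : ℕ × ℕ) {M : ℝ} (hM : ∀ p, |φ p| ≤ M) : |sineCoeff L H q φ| ≤ L * H * M := by
  have hvol : volume (plate L H) = ENNReal.ofReal (L * H) := by
    rw [plate, Measure.volume_eq_prod, Measure.prod_prod, Real.volume_Icc, Real.volume_Icc,
      sub_zero, sub_zero, ENNReal.ofReal_mul hL.le]
  have := norm_setIntegral_le_of_norm_le_const (μ := volume) (s := plate L H)
    (f := fun p => sineMode L H (q.1 + 1) (q.2 + 1) p * φ p) (C := M)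
    (by rw [hvol]; exact ENNReal.ofReal_lt_top) (fun p _ => by
      rw [Real.norm_eq_abs, abs_mul]
      exact (mul_le_of_le_one_left (abs_nonneg _) (abs_sineMode_le ..)).trans (hM p))
  rw [Measure.real, hvol, ENNReal.toReal_ofReal (by positivity)] at this
  rw [sineCoeff, ← Real.norm_eq_abs]
  linarith

/-- The weight `(m + 1)(n + 1)`. -/
def modeWeight (q : ℕ × ℕ) : ℝ := ((q.1 : ℝ) + 1) * ((q.2 : ℝ) + 1)

theorem one_le_modeWeight (q : ℕ × ℕ) : 1 ≤ modeWeight q := by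
  unfold modeWeight
  have h1 : (0 : ℝ) ≤ q.1 := by positivity
  have h2 : (0 : ℝ) ≤ q.2 := by positivity
  nlinarith

theorem modeWeight_pos (q : ℕ × ℕ) : 0 < modeWeight q :=
  zero_lt_one.trans_le (one_le_modeWeight q)

theorem freq_mul_freq {L H : ℝ} (hL : 0 < L) (hH : 0 < H) (q : ℕ × ℕ) :
    freq L (q.1 + 1) * freq H (q.2 + 1) = Real.pi ^ 2 / (L * H) * modeWeight q := by
  unfold freq modeWeight; push_cast; field_simp

/-- Taking 2N derivatives in each variable multiplies the coefficient by (μγ)^(2N), which is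
proportional to the mode weight to the same power. The constant does not depend on the test
function, so this is also the seminorm estimate behind `exists_distribution`. -/
theorem sineCoeff_decay {L H : ℝ} (hL : 0 < L) (hH : 0 < H) (N : ℕ) :
    ∃ C : ℝ, 0 ≤ C ∧ ∀ (φ : ℝ × ℝ → ℝ), IsDirichletTest L H φ → ∀ M : ℝ,
      (∀ p, |partialX^[2 * N] (partialY^[2 * N] φ) p| ≤ M) →
      ∀ q, |sineCoeff L H q φ| * modeWeight q ^ (2 * N) ≤ C * M := by
  refine ⟨L * H * (L * H / Real.pi ^ 2) ^ (2 * N), by positivity, fun φ hφ M hM q => ?_⟩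
  have h1 := abs_sineCoeff_le hL hH q hM
  have e : (-freq L (q.1 + 1) ^ 2) ^ N * (-freq H (q.2 + 1) ^ 2) ^ N
      = (Real.pi ^ 2 / (L * H)) ^ (2 * N) * modeWeight q ^ (2 * N) := by
    rw [← mul_pow, ← mul_pow, ← freq_mul_freq hL hH, pow_mul]
    congr 1
    ring
  have hpos := modeWeight_pos q
  rw [sineCoeff_iterate hL hH hφ, e, abs_mul, abs_of_nonneg (by positivity)] at h1
  calc |sineCoeff L H q φ| * modeWeight q ^ (2 * N)
      = (L * H / Real.pi ^ 2) ^ (2 * N) * ((Real.pi ^ 2 / (L * H)) ^ (2 * N)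
        * modeWeight q ^ (2 * N) * |sineCoeff L H q φ|) := by
        have : (L * H / Real.pi ^ 2) ^ (2 * N) * (Real.pi ^ 2 / (L * H)) ^ (2 * N) = 1 := by
          rw [← mul_pow]
          have : L * H / Real.pi ^ 2 * (Real.pi ^ 2 / (L * H)) = 1 := by field_simp
          rw [this, one_pow]
        linear_combination -(|sineCoeff L H q φ| * modeWeight q ^ (2 * N)) * this
    _ ≤ (L * H / Real.pi ^ 2) ^ (2 * N) * (L * H * M) := by gcongr
    _ = _ := by ring

theorem IsDirichletTest.bounded {L H : ℝ} (hL : 0 < L) (hH : 0 < H) {φ : ℝ × ℝ → ℝ}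
    (h : IsDirichletTest L H φ) : ∃ M, ∀ p, |φ p| ≤ M := by
  obtain ⟨M, hM⟩ := (isCompact_Icc.prod isCompact_Icc :
    IsCompact (Set.Icc 0 (2 * L) ×ˢ Set.Icc 0 (2 * H))).exists_bound_of_continuousOn
      h.smooth.continuous.continuousOn
  refine ⟨M, fun p => ?_⟩
  obtain ⟨x, y⟩ := p
  have hx : Function.Periodic (fun x => φ (x, y)) (2 * L) := fun x => h.periodic_x x y
  obtain ⟨x', hx', ex⟩ := hx.exists_mem_Ico₀ (by linarith) x
  have hy : Function.Periodic (fun y => φ (x', y)) (2 * H) := fun y => h.periodic_y x' y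
  obtain ⟨y', hy', ey⟩ := hy.exists_mem_Ico₀ (by linarith) y
  rw [ex, ey]
  exact hM (x', y') ⟨⟨hx'.1, hx'.2.le⟩, ⟨hy'.1, hy'.2.le⟩⟩

theorem summable_modeWeight : Summable fun q : ℕ × ℕ => (modeWeight q ^ 2)⁻¹ := by
  have h : Summable fun n : ℕ => (((n : ℝ) + 1) ^ 2)⁻¹ := by
    have := (summable_nat_add_iff 1).2 (Real.summable_nat_pow_inv (p := 2) |>.2 (by norm_num))
    simpa using this
  refine (h.mul_of_nonneg h (fun n => by positivity) fun n => by positivity).congr fun q => ?_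
  rw [modeWeight, mul_pow, mul_inv]

/-- Rapid decay of the sine coefficients of a test function. -/
theorem summable_sineCoeff {L H : ℝ} (hL : 0 < L) (hH : 0 < H) {φ : ℝ × ℝ → ℝ}
    (h : IsDirichletTest L H φ) (N : ℕ) :
    Summable fun q => |sineCoeff L H q φ| * modeWeight q ^ N := by
  -- With N + 1 the available decay exponent 2(N + 1) is at least N + 2, leaving the summable factor
  -- 1/weight² to spare.
  obtain ⟨C, hC0, hC⟩ := sineCoeff_decay hL hH (N + 1)
  obtain ⟨M, hM⟩ := ((h.iterate_partialY (N + 1)).iterate_partialX (N + 1)).bounded hL hH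
  refine Summable.of_nonneg_of_le (fun q => ?_) (fun q => ?_) (summable_modeWeight.mul_left (C * M))
  · have := modeWeight_pos q; positivity
  · have h1 := hC φ h M hM q
    have hp := modeWeight_pos q
    rw [← div_eq_mul_inv, le_div_iff₀ (by positivity)]
    refine le_trans ?_ h1
    rw [mul_assoc, ← pow_add]
    gcongr
    · exact one_le_modeWeight q
    · omega

/-- One double integration by parts gives O(1/m²). This is used on the slices of a test function
with y frozen. -/
theorem summable_sine_integral {L : ℝ} (hL : 0 < L) {f f' f'' : ℝ → ℝ}
    (hf' : ∀ x, HasDerivAt f (f' x) x)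
    (hf'' : ∀ x, HasDerivAt f' (f'' x) x) (hc : Continuous f'')
    (hodd : ∀ x, f (-x) = -f x) (hper : ∀ x, f (x + 2 * L) = f x) :
    Summable fun m : ℕ => ∫ u in (0 : ℝ)..L, Real.sin (freq L (m + 1) * u) * f u := by
  obtain ⟨M, hM⟩ := (isCompact_uIcc (a := 0) (b := L)).exists_bound_of_continuousOn
    hc.continuousOn
  have h : Summable fun n : ℕ => (((n : ℝ) + 1) ^ 2)⁻¹ := by
    have := (summable_nat_add_iff 1).2 (Real.summable_nat_pow_inv (p := 2) |>.2 (by norm_num))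
    simpa using this
  refine Summable.of_norm_bounded (h.mul_left (M * |L - 0| * (L / Real.pi) ^ 2)) fun m => ?_
  have h1 := integral_sin_mul_deriv_deriv hL hf' hf'' hc hodd hper (m + 1)
  have h2 : ‖∫ u in (0 : ℝ)..L, Real.sin (freq L (m + 1) * u) * f'' u‖ ≤ M * |L - 0| := by
    refine intervalIntegral.norm_integral_le_of_norm_le_const fun x hx => ?_
    rw [norm_mul]
    exact (mul_le_of_le_one_left (norm_nonneg _) (Real.abs_sin_le_one _)).trans
      (hM x (Set.uIoc_subset_uIcc hx))
  rw [h1, norm_mul, norm_neg, norm_pow, Real.norm_of_nonneg (freq_pos hL m).le] at h2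
  have hm : freq L (m + 1) ^ 2 = ((m : ℝ) + 1) ^ 2 / (L / Real.pi) ^ 2 := by
    unfold freq; push_cast; field_simp
  rw [hm, div_mul_eq_mul_div, div_le_iff₀ (by positivity)] at h2
  rw [← div_eq_mul_inv, le_div_iff₀ (by positivity)]
  linarith

/-- The sine expansion of a test function. -/
theorem hasSum_sineMode {L H : ℝ} (hL : 0 < L) (hH : 0 < H) {φ : ℝ × ℝ → ℝ}
    (h : IsDirichletTest L H φ) (p : ℝ × ℝ) :
    HasSum (fun q : ℕ × ℕ => 4 / (L * H) * sineCoeff L H q φ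
      * sineMode L H (q.1 + 1) (q.2 + 1) p) (φ p) := by
  obtain ⟨x, y⟩ := p
  have hφ := h.smooth.continuous
  have hs0 := summable_sineCoeff hL hH h 0
  simp only [pow_zero, mul_one] at hs0
  have hs : Summable fun q : ℕ × ℕ => 4 / (L * H) * sineCoeff L H q φ
      * sineMode L H (q.1 + 1) (q.2 + 1) (x, y) := by
    refine Summable.of_norm_bounded (hs0.mul_left (4 / (L * H))) fun q => ?_
    rw [norm_mul, norm_mul, Real.norm_of_nonneg (by positivity : 0 ≤ 4 / (L * H))]
    exact mul_le_of_le_one_right (by positivity) (abs_sineMode_le ..)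
  have hx := hasSum_sine_series hL (f := fun x => φ (x, y)) (by fun_prop)
    (fun x => h.odd_x x y) (fun x => h.periodic_x x y)
    (summable_sine_integral hL (fun x => hasDerivAt_partialX h.smooth x y)
    (fun x => hasDerivAt_partialX (partialX_smooth h.smooth) x y)
    (h.partialX_partialX.smooth.continuous.comp (by fun_prop))
    (fun x => h.odd_x x y) (fun x => h.periodic_x x y)) x
  -- For fixed m the sum over n is the sine series in y of the m-th partial coefficient v ↦ ∫
  -- sin(μu) φ(u, v) du; summing over m afterwards is the sine series in x. Absolute summability of
  -- the double series lets the iterated sum be identified with it.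
  have hy : ∀ m : ℕ, HasSum (fun n : ℕ => 4 / (L * H) * sineCoeff L H (m, n) φ
      * sineMode L H (m + 1) (n + 1) (x, y))
      (2 / L * (∫ u in (0 : ℝ)..L, Real.sin (freq L (m + 1) * u) * φ (u, y))
        * Real.sin (freq L (m + 1) * x)) := by
    intro m
    have hcoe : ∀ n : ℕ, ∫ v in (0 : ℝ)..H, Real.sin (freq H (n + 1) * v)
        * ∫ u in (0 : ℝ)..L, Real.sin (freq L (m + 1) * u) * φ (u, v)
        = sineCoeff L H (m, n) φ := fun n => (sineCoeff_eq_symm hL hH hφ (m, n)).symm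
    have hsm : Summable fun n : ℕ => sineCoeff L H (m, n) φ := by
      have h3 : Summable fun n : ℕ => |sineCoeff L H (m, n) φ| :=
        hs0.comp_injective (i := fun n : ℕ => (m, n)) (Prod.mk_right_injective m)
      exact h3.of_abs
    have hφ' : Continuous fun v => ∫ u in (0 : ℝ)..L, Real.sin (freq L (m + 1) * u) * φ (u, v) :=
      intervalIntegral.continuous_parametric_intervalIntegral_of_continuous' (by
        simp only [Function.uncurry_def]; fun_prop) _ _
    have := hasSum_sine_series hH
      (f := fun v => ∫ u in (0 : ℝ)..L, Real.sin (freq L (m + 1) * u) * φ (u, v))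
      hφ'
      (fun v => by simp only [h.odd_y, mul_neg, intervalIntegral.integral_neg])
      (fun v => by simp only [h.periodic_y])
      (by
        simp only [hcoe]
        exact hsm) y
    simp only [hcoe] at this
    have h2 := this.mul_left (2 / L * Real.sin (freq L (m + 1) * x))
    rw [mul_right_comm] at h2
    refine (congrArg (fun F => HasSum F _) (funext fun n => ?_)).mpr h2
    simp only [sineMode]
    field_simp
    ring
  rw [← (hs.hasSum.prod_fiberwise hy).unique hx]
  exact hs.hasSum

/-! ### The sine modes as test functions -/

theorem contDiff_sineMode (L H : ℝ) (m n : ℕ) : ContDiff ℝ ∞ (sineMode L H m n) := by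
  unfold sineMode
  exact (Real.contDiff_sin.comp (contDiff_const.mul contDiff_fst)).mul
    (Real.contDiff_sin.comp (contDiff_const.mul contDiff_snd))

theorem sin_freq_mul_add_period {L : ℝ} (hL : 0 < L) (m : ℕ) (x : ℝ) :
    Real.sin (freq L m * (x + 2 * L)) = Real.sin (freq L m * x) := by
  rw [show freq L m * (x + 2 * L) = freq L m * x + m * (2 * Real.pi) by unfold freq; field_simp]
  exact Real.sin_add_nat_mul_two_pi _ m

theorem isDirichletTest_sineMode {L H : ℝ} (hL : 0 < L) (hH : 0 < H) (m n : ℕ) :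
    IsDirichletTest L H (sineMode L H m n) where
  smooth := contDiff_sineMode L H m n
  odd_x x y := by simp [sineMode]
  odd_y x y := by simp [sineMode]
  periodic_x x y := by simp only [sineMode, sin_freq_mul_add_period hL]
  periodic_y x y := by simp only [sineMode, sin_freq_mul_add_period hH]

/-- The sine mode with index `q`, numbered from zero, as a test function. -/
def sineTest {L H : ℝ} (hL : 0 < L) (hH : 0 < H) (q : ℕ × ℕ) : DirichletTest L H :=
  ⟨sineMode L H (q.1 + 1) (q.2 + 1), isDirichletTest_sineMode hL hH _ _⟩

theorem partialX_partialX_sineMode (L H : ℝ) (m n : ℕ) :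
    partialX (partialX (sineMode L H m n)) = -freq L m ^ 2 • sineMode L H m n := by
  have h1 : partialX (sineMode L H m n)
      = fun p => freq L m * Real.cos (freq L m * p.1) * Real.sin (freq H n * p.2) := by
    ext ⟨x, y⟩
    rw [partialX_eq_deriv (contDiff_sineMode L H m n)]
    refine HasDerivAt.deriv ?_
    exact (((((hasDerivAt_id x).const_mul (freq L m)).sin).mul_const
      (Real.sin (freq H n * y)))).congr_deriv (by simp only [id]; ring)
  have h2 := partialX_smooth (contDiff_sineMode L H m n)
  ext ⟨x, y⟩
  rw [partialX_eq_deriv h2, h1]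
  refine HasDerivAt.deriv ?_
  exact ((((((hasDerivAt_id x).const_mul (freq L m)).cos).const_mul (freq L m)).mul_const
      (Real.sin (freq H n * y)))).congr_deriv (by simp [sineMode]; ring)

theorem partialY_partialY_sineMode (L H : ℝ) (m n : ℕ) :
    partialY (partialY (sineMode L H m n)) = -freq H n ^ 2 • sineMode L H m n := by
  have h1 : partialY (sineMode L H m n)
      = fun p => Real.sin (freq L m * p.1) * (freq H n * Real.cos (freq H n * p.2)) := by
    ext ⟨x, y⟩
    rw [partialY_eq_deriv (contDiff_sineMode L H m n)]
    refine HasDerivAt.deriv ?_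
    exact (((((hasDerivAt_id y).const_mul (freq H n)).sin).const_mul
      (Real.sin (freq L m * x)))).congr_deriv (by simp only [id]; ring)
  have h2 := partialY_smooth (contDiff_sineMode L H m n)
  ext ⟨x, y⟩
  rw [partialY_eq_deriv h2, h1]
  refine HasDerivAt.deriv ?_
  exact ((((((hasDerivAt_id y).const_mul (freq H n)).cos).const_mul (freq H n)).const_mul
      (Real.sin (freq L m * x)))).congr_deriv (by simp [sineMode]; ring)

theorem testLaplacian_sineTest {L H : ℝ} (hL : 0 < L) (hH : 0 < H) (q : ℕ × ℕ) :
    testLaplacian (sineTest hL hH q)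
      = -lambdaSq L H (q.1 + 1) (q.2 + 1) • sineTest hL hH q := by
  refine Subtype.ext ?_
  change planeLaplacian (sineMode L H (q.1 + 1) (q.2 + 1))
    = -lambdaSq L H (q.1 + 1) (q.2 + 1) • sineMode L H (q.1 + 1) (q.2 + 1)
  ext p
  rw [planeLaplacian, partialX_partialX_sineMode, partialY_partialY_sineMode]
  simp only [Pi.smul_apply, smul_eq_mul, lambdaSq]
  ring

/-! ### Termwise differentiation of sine series -/

/-- The mixed derivative of order `(i, j)` of the sine mode with index `q`. -/
def sineModeDeriv (L H : ℝ) (i j : ℕ) (q : ℕ × ℕ) (p : ℝ × ℝ) : ℝ :=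
  freq L (q.1 + 1) ^ i * freq H (q.2 + 1) ^ j
    * (Real.sin (freq L (q.1 + 1) * p.1 + i * (Real.pi / 2))
      * Real.sin (freq H (q.2 + 1) * p.2 + j * (Real.pi / 2)))

/-- A constant comparing frequencies with mode weights. -/
def freqConst (L H : ℝ) : ℝ := Real.pi / L + Real.pi / H + 1

theorem one_le_freqConst {L H : ℝ} (hL : 0 < L) (hH : 0 < H) : 1 ≤ freqConst L H := by
  have : 0 ≤ Real.pi / L + Real.pi / H := by positivity
  unfold freqConst
  linarith

theorem one_le_freqConst_mul {L H : ℝ} (hL : 0 < L) (hH : 0 < H) (q : ℕ × ℕ) :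
    1 ≤ freqConst L H * modeWeight q :=
  one_le_mul_of_one_le_of_one_le (one_le_freqConst hL hH) (one_le_modeWeight q)

theorem freq_left_le {L H : ℝ} (hL : 0 < L) (hH : 0 < H) (q : ℕ × ℕ) :
    freq L (q.1 + 1) ≤ freqConst L H * modeWeight q := by
  have h1 : freq L (q.1 + 1) = Real.pi / L * ((q.1 : ℝ) + 1) := by
    unfold freq; push_cast; ring
  have h2 : (0 : ℝ) < Real.pi / L := by positivity
  have h3 : (0 : ℝ) < Real.pi / H := by positivity
  rw [h1, freqConst, modeWeight]
  gcongr
  · linarith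
  · exact le_mul_of_one_le_right (by positivity) (by simp)

theorem freq_right_le {L H : ℝ} (hL : 0 < L) (hH : 0 < H) (q : ℕ × ℕ) :
    freq H (q.2 + 1) ≤ freqConst L H * modeWeight q := by
  have h1 : freq H (q.2 + 1) = Real.pi / H * ((q.2 : ℝ) + 1) := by
    unfold freq; push_cast; ring
  have h2 : (0 : ℝ) < Real.pi / L := by positivity
  have h3 : (0 : ℝ) < Real.pi / H := by positivity
  rw [h1, freqConst, modeWeight]
  gcongr
  · linarith
  · exact le_mul_of_one_le_left (by positivity) (by simp)

theorem abs_sineModeDeriv_le {L H : ℝ} (hL : 0 < L) (hH : 0 < H) {i j N : ℕ} (hN : i + j ≤ N)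
    (q : ℕ × ℕ) (p : ℝ × ℝ) :
    |sineModeDeriv L H i j q p| ≤ (freqConst L H * modeWeight q) ^ N := by
  have h1 := freq_pos hL q.1
  have h2 := freq_pos hH q.2
  have h3 := one_le_freqConst_mul hL hH q
  rw [sineModeDeriv, abs_mul, abs_mul (Real.sin _),
    abs_of_nonneg (by positivity : 0 ≤ freq L (q.1 + 1) ^ i * freq H (q.2 + 1) ^ j)]
  calc _ ≤ freq L (q.1 + 1) ^ i * freq H (q.2 + 1) ^ j * 1 := by
        gcongr
        exact mul_le_one₀ (Real.abs_sin_le_one _) (abs_nonneg _) (Real.abs_sin_le_one _)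
    _ ≤ (freqConst L H * modeWeight q) ^ i * (freqConst L H * modeWeight q) ^ j := by
        rw [mul_one]
        gcongr
        · exact freq_left_le hL hH q
        · exact freq_right_le hL hH q
    _ = (freqConst L H * modeWeight q) ^ (i + j) := (pow_add _ _ _).symm
    _ ≤ _ := pow_le_pow_right₀ h3 hN

/-- Differentiating a sine shifts its phase by π/2, so one formula covers derivatives of every order
and no parity cases arise. -/
theorem hasDerivAt_sineModeDeriv_left (L H : ℝ) (i j : ℕ) (q : ℕ × ℕ) (x y : ℝ) :
    HasDerivAt (fun s => sineModeDeriv L H i j q (s, y)) (sineModeDeriv L H (i + 1) j q (x, y))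
      x := by
  have h : HasDerivAt (fun s => Real.sin (freq L (q.1 + 1) * s + i * (Real.pi / 2)))
      (Real.cos (freq L (q.1 + 1) * x + i * (Real.pi / 2)) * freq L (q.1 + 1)) x :=
    ((((hasDerivAt_id x).const_mul (freq L (q.1 + 1))).add_const _).sin).congr_deriv
      (by simp only [id]; ring)
  have e : Real.sin (freq L (q.1 + 1) * x + ((i + 1 : ℕ) : ℝ) * (Real.pi / 2))
      = Real.cos (freq L (q.1 + 1) * x + i * (Real.pi / 2)) := by
    rw [← Real.sin_add_pi_div_two]; congr 1; push_cast; ring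
  simp only [sineModeDeriv]
  rw [e]
  refine ((h.mul_const _).const_mul _).congr_deriv ?_
  ring

theorem hasDerivAt_sineModeDeriv_right (L H : ℝ) (i j : ℕ) (q : ℕ × ℕ) (x y : ℝ) :
    HasDerivAt (fun s => sineModeDeriv L H i j q (x, s)) (sineModeDeriv L H i (j + 1) q (x, y))
      y := by
  have h : HasDerivAt (fun s => Real.sin (freq H (q.2 + 1) * s + j * (Real.pi / 2)))
      (Real.cos (freq H (q.2 + 1) * y + j * (Real.pi / 2)) * freq H (q.2 + 1)) y :=
    ((((hasDerivAt_id y).const_mul (freq H (q.2 + 1))).add_const _).sin).congr_deriv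
      (by simp only [id]; ring)
  have e : Real.sin (freq H (q.2 + 1) * y + ((j + 1 : ℕ) : ℝ) * (Real.pi / 2))
      = Real.cos (freq H (q.2 + 1) * y + j * (Real.pi / 2)) := by
    rw [← Real.sin_add_pi_div_two]; congr 1; push_cast; ring
  simp only [sineModeDeriv]
  rw [e]
  refine ((h.const_mul _).const_mul _).congr_deriv ?_
  ring

theorem summable_mul_sineModeDeriv_bound {L H : ℝ} {c : ℕ × ℕ → ℝ}
    (hc : ∀ N, Summable fun q => |c q| * modeWeight q ^ N) (N : ℕ) :
    Summable fun q => |c q| * (freqConst L H * modeWeight q) ^ N := by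
  refine ((hc N).mul_left (freqConst L H ^ N)).congr fun q => ?_
  rw [mul_pow]; ring

theorem norm_mul_sineModeDeriv_le {L H : ℝ} (hL : 0 < L) (hH : 0 < H) (c : ℕ × ℕ → ℝ)
    {i j N : ℕ} (hN : i + j ≤ N) (q : ℕ × ℕ) (p : ℝ × ℝ) :
    ‖c q * sineModeDeriv L H i j q p‖ ≤ |c q| * (freqConst L H * modeWeight q) ^ N := by
  rw [norm_mul]
  exact mul_le_mul_of_nonneg_left (abs_sineModeDeriv_le hL hH hN q p) (abs_nonneg _)

/-- Each derivative costs at most one power of the frequency, hence of the weight, and rapid decay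
of c absorbs it. The y-derivatives are produced first, matching the order of composition. -/
theorem hasSum_sineModeDeriv {L H : ℝ} (hL : 0 < L) (hH : 0 < H) {c : ℕ × ℕ → ℝ}
    (hc : ∀ N, Summable fun q => |c q| * modeWeight q ^ N) {φ : ℝ × ℝ → ℝ}
    (hφ : ContDiff ℝ ∞ φ)
    (h : ∀ p, HasSum (fun q => c q * sineMode L H (q.1 + 1) (q.2 + 1) p) (φ p)) (i j : ℕ)
    (p : ℝ × ℝ) : HasSum (fun q => c q * sineModeDeriv L H i j q p)
      (partialX^[i] (partialY^[j] φ) p) := by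
  have hsum : ∀ i j p, Summable fun q => c q * sineModeDeriv L H i j q p := fun i j p =>
    Summable.of_norm_bounded (summable_mul_sineModeDeriv_bound hc (i + j))
      fun q => norm_mul_sineModeDeriv_le hL hH c le_rfl q p
  induction i generalizing p with
  | zero =>
    induction j generalizing p with
    | zero =>
      have := h p
      simpa [sineModeDeriv, sineMode] using this
    | succ j ih =>
      obtain ⟨x, y⟩ := p
      have hd := hasDerivAt_tsum (summable_mul_sineModeDeriv_bound (L := L) (H := H) hc
        (0 + (j + 1))) (fun q s => (hasDerivAt_sineModeDeriv_right L H 0 j q x s).const_mul (c q))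
        (fun q s => norm_mul_sineModeDeriv_le hL hH c le_rfl q (x, s)) (hsum 0 j (x, y)) y
      have e : (fun s => ∑' q, c q * sineModeDeriv L H 0 j q (x, s))
          = fun s => partialY^[j] φ (x, s) := funext fun s => (ih (x, s)).tsum_eq
      rw [e] at hd
      rw [Function.iterate_zero, id, Function.iterate_succ_apply',
        (hasDerivAt_partialY (partialY_iterate_smooth hφ j) x y).unique hd]
      exact (hsum 0 (j + 1) (x, y)).hasSum
  | succ i ih =>
    obtain ⟨x, y⟩ := p
    have hd := hasDerivAt_tsum (summable_mul_sineModeDeriv_bound (L := L) (H := H) hc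
      (i + 1 + j)) (fun q s => (hasDerivAt_sineModeDeriv_left L H i j q s y).const_mul (c q))
      (fun q s => norm_mul_sineModeDeriv_le hL hH c le_rfl q (s, y)) (hsum i j (x, y)) x
    have e : (fun s => ∑' q, c q * sineModeDeriv L H i j q (s, y))
        = fun s => partialX^[i] (partialY^[j] φ) (s, y) := funext fun s => (ih (s, y)).tsum_eq
    rw [e] at hd
    rw [Function.iterate_succ_apply', (hasDerivAt_partialX
      (partialX_iterate_smooth (partialY_iterate_smooth hφ j) i) x y).unique hd]
    exact (hsum (i + 1) j (x, y)).hasSum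

/-! ### Distributions and their sine coefficients -/

theorem HasSum.sub_ite_mem {ι : Type*} {f : ι → ℝ} {a : ℝ} (h : HasSum f a)
    (F : Finset ι) [DecidableEq ι] :
    HasSum (fun q => if q ∈ F then 0 else f q) (a - ∑ q ∈ F, f q) := by
  have h1 : HasSum (fun q => if q ∈ F then f q else 0) (∑ q ∈ F, f q) := by
    have := hasSum_sum_of_ne_finset_zero (f := fun q => if q ∈ F then f q else 0) (s := F)
      (L := SummationFilter.unconditional ι)
      (fun q hq => if_neg hq)
    rwa [Finset.sum_congr rfl (fun q hq => if_pos hq)] at this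
  refine (congrArg (fun G => HasSum G _) (funext fun q => ?_)).mpr (h.sub h1)
  split_ifs <;> simp

/-- The sine series of φ converges to φ in the topology of the test space, so T may be applied term
by term. Quantitatively, the remainder after a finite set F has its derivatives controlled by the
tail of a convergent series, and the continuity bound of T passes this on to the value. -/
theorem DirichletDistribution.hasSum_sineCoeff {L H : ℝ} (hL : 0 < L) (hH : 0 < H)
    (T : DirichletDistribution L H) (φ : DirichletTest L H) :
    HasSum (fun q => 4 / (L * H) * sineCoeff L H q φ * T (sineTest hL hH q)) (T φ) := by
  classical
  obtain ⟨C, N, hC⟩ := T.continuous'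
  set c : ℕ × ℕ → ℝ := fun q => 4 / (L * H) * sineCoeff L H q φ with hcdef
  have hc : ∀ N, Summable fun q => |c q| * modeWeight q ^ N := fun N => by
    refine ((summable_sineCoeff hL hH φ.2 N).mul_left (4 / (L * H))).congr fun q => ?_
    rw [hcdef, abs_mul, abs_of_nonneg (by positivity : 0 ≤ 4 / (L * H)), mul_assoc]
  -- The continuity bound allows up to N derivatives in each variable, so total order N + N.
  set u : ℕ × ℕ → ℝ := fun q => |c q| * (freqConst L H * modeWeight q) ^ (N + N) with hu
  have hus : Summable u := summable_mul_sineModeDeriv_bound hc (N + N)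
  have key : ∀ F : Finset (ℕ × ℕ),
      ‖T φ - ∑ q ∈ F, c q * T (sineTest hL hH q)‖ ≤ C * (∑' q, u q - ∑ q ∈ F, u q) := by
    intro F
    set R : DirichletTest L H := φ - ∑ q ∈ F, c q • sineTest hL hH q with hR
    have hRT : T R = T φ - ∑ q ∈ F, c q * T (sineTest hL hH q) := by
      simp only [hR, map_sub, map_sum, map_smul, smul_eq_mul]
    rw [← hRT]
    refine hC R _ fun i j hi hj p => ?_
    -- The remainder is again a test function; its expansion is that of φ with the modes in F
    -- deleted.
    set d : ℕ × ℕ → ℝ := fun q => if q ∈ F then 0 else c q with hd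
    have hds : ∀ N, Summable fun q => |d q| * modeWeight q ^ N := fun N => by
      refine Summable.of_nonneg_of_le (fun q => ?_) (fun q => ?_) (hc N)
      · have := modeWeight_pos q; positivity
      · have := modeWeight_pos q
        simp only [hd]
        split_ifs
        · simp only [abs_zero, zero_mul]; positivity
        · exact le_rfl
    have hsumR : ∀ p, HasSum (fun q => d q * sineMode L H (q.1 + 1) (q.2 + 1) p)
        ((R : ℝ × ℝ → ℝ) p) := fun p => by
      have h1 := (hasSum_sineMode hL hH φ.2 p).sub_ite_mem F
      have h2 : (R : ℝ × ℝ → ℝ) p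
          = (φ : ℝ × ℝ → ℝ) p - ∑ q ∈ F, c q * sineMode L H (q.1 + 1) (q.2 + 1) p := by
        simp only [hR, Submodule.coe_sub, Submodule.coe_sum, Submodule.coe_smul, Pi.sub_apply,
          Finset.sum_apply, Pi.smul_apply, smul_eq_mul, sineTest]
      rw [h2]
      refine (congrArg (fun G => HasSum G _) (funext fun q => ?_)).mpr h1
      simp only [hd]
      split_ifs <;> simp [hcdef]
    have h3 := hasSum_sineModeDeriv hL hH hds R.2.smooth hsumR i j p
    refine h3.norm_le_of_bounded (hus.hasSum.sub_ite_mem F) fun q => ?_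
    refine (norm_mul_sineModeDeriv_le hL hH d (add_le_add hi hj) q p).trans ?_
    simp only [hd, hu]
    split_ifs <;> simp
  rw [HasSum, SummationFilter.unconditional_filter, tendsto_iff_norm_sub_tendsto_zero]
  have hz : Tendsto (fun F : Finset (ℕ × ℕ) => C * (∑' q, u q - ∑ q ∈ F, u q)) atTop (𝓝 0) := by
    have h1 : Tendsto (fun F : Finset (ℕ × ℕ) => ∑ q ∈ F, u q) atTop (𝓝 (∑' q, u q)) := hus.hasSum
    simpa using (h1.const_sub (∑' q, u q)).const_mul C
  refine squeeze_zero (fun _ => norm_nonneg _) (fun F => ?_) hz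
  rw [norm_sub_rev]
  exact key F

theorem summable_mul_sineCoeff {L H : ℝ} (hL : 0 < L) (hH : 0 < H) {c : ℕ × ℕ → ℝ} {C : ℝ} {K : ℕ}
    (hc : ∀ q, |c q| ≤ C * modeWeight q ^ K) {φ : ℝ × ℝ → ℝ} (h : IsDirichletTest L H φ) :
    Summable fun q => c q * sineCoeff L H q φ := by
  refine Summable.of_norm_bounded ((summable_sineCoeff hL hH h K).mul_left C) fun q => ?_
  rw [norm_mul, Real.norm_eq_abs, Real.norm_eq_abs]
  calc _ ≤ C * modeWeight q ^ K * |sineCoeff L H q φ| := by gcongr; exact hc q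
    _ = _ := by ring

/-- Coefficients of polynomial growth define a distribution. -/
theorem exists_distribution {L H : ℝ} (hL : 0 < L) (hH : 0 < H) {c : ℕ × ℕ → ℝ} {C : ℝ} {K : ℕ}
    (hc : ∀ q, |c q| ≤ C * modeWeight q ^ K) :
    ∃ S : DirichletDistribution L H, ∀ φ : DirichletTest L H,
      HasSum (fun q => c q * sineCoeff L H q φ) (S φ) := by
  have hs : ∀ φ : DirichletTest L H, Summable fun q => c q * sineCoeff L H q φ := fun φ =>
    summable_mul_sineCoeff hL hH hc φ.2
  obtain ⟨D, hD0, hD⟩ := sineCoeff_decay hL hH (K + 1)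
  have hC0 : 0 ≤ C := by
    have := (abs_nonneg _).trans (hc (0, 0))
    exact nonneg_of_mul_nonneg_left this (pow_pos (modeWeight_pos _) _)
  -- Growth of order K is beaten with a summable 1/weight² left over once the coefficients of φ
  -- decay like weight^(-(K+2)); 2(K + 1) derivatives in each variable suffice.
  refine ⟨⟨⟨⟨fun φ => ∑' q, c q * sineCoeff L H q φ, fun φ ψ => ?_⟩, fun a φ => ?_⟩,
    ⟨C * D * ∑' q, (modeWeight q ^ 2)⁻¹, 2 * (K + 1), fun φ M hM => ?_⟩⟩, fun φ => (hs φ).hasSum⟩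
  · rw [← (hs φ).tsum_add (hs ψ)]
    refine tsum_congr fun q => ?_
    rw [Submodule.coe_add, sineCoeff_add φ.2.smooth.continuous ψ.2.smooth.continuous, mul_add]
  · simp only [RingHom.id_apply, smul_eq_mul]
    rw [← tsum_mul_left]
    refine tsum_congr fun q => ?_
    rw [Submodule.coe_smul, sineCoeff_smul]
    ring
  · have hbd := hD φ φ.2 M (hM _ _ le_rfl le_rfl)
    have h2 := (summable_modeWeight.hasSum.mul_left (C * D * M))
    have h3 := (hs φ).hasSum.norm_le_of_bounded h2 fun q => ?_
    · refine h3.trans (le_of_eq ?_)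
      ring
    · have hp := modeWeight_pos q
      rw [← div_eq_mul_inv, le_div_iff₀ (by positivity), norm_mul, Real.norm_eq_abs,
        Real.norm_eq_abs]
      calc |c q| * |sineCoeff L H q φ| * modeWeight q ^ 2
          ≤ C * modeWeight q ^ K * |sineCoeff L H q φ| * modeWeight q ^ 2 := by
            gcongr; exact hc q
        _ = C * (|sineCoeff L H q φ| * modeWeight q ^ (K + 2)) := by ring
        _ ≤ C * (|sineCoeff L H q φ| * modeWeight q ^ (2 * (K + 1))) := by
            gcongr
            · exact one_le_modeWeight q
            · omega
        _ ≤ C * (D * M) := mul_le_mul_of_nonneg_left (hbd q) hC0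
        _ = _ := by ring

/-! ### The scalar evolution equations of the modes -/

/-- Real fundamental solutions of `S'' = ρ S`, with `β S = sinh (β ·)` whenever `β² = ρ`. -/
theorem exists_fundamental_pair {β : ℂ} {ρ : ℝ} (h : β ^ 2 = ρ) :
    ∃ S C : ℝ → ℝ, (∀ s, HasDerivAt S (C s) s) ∧ (∀ s, HasDerivAt C (ρ * S s) s) ∧
      (∀ t s, S (t - s) = S t * C s - C t * S s) ∧ (∀ s, C s ^ 2 - ρ * S s ^ 2 = 1) ∧
      (∀ s : ℝ, Complex.sinh (β * s) = β * S s) ∧ (β = 0 → ∀ s, S s = s) := by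
  -- With r = √|ρ|, S is sin(rs)/r, s or sinh(rs)/r. The number β may be either complex root of ρ;
  -- the sign cancels because sinh is odd.
  rcases lt_trichotomy ρ 0 with hρ | hρ | hρ
  · set r := Real.sqrt (-ρ) with hr
    have hr0 : 0 < r := Real.sqrt_pos.2 (by linarith)
    have hr2 : r ^ 2 = -ρ := Real.sq_sqrt (by linarith)
    have hrc : (r : ℂ) ≠ 0 := by exact_mod_cast hr0.ne'
    have hβ : β = r * Complex.I ∨ β = -(r * Complex.I) := by
      rw [← sq_eq_sq_iff_eq_or_eq_neg, h, mul_pow, Complex.I_sq, ← Complex.ofReal_pow, hr2]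
      push_cast; ring
    have hd : ∀ s, HasDerivAt (fun s => r * s) r s := fun s => by
      simpa using (hasDerivAt_id s).const_mul r
    refine ⟨fun s => Real.sin (r * s) / r, fun s => Real.cos (r * s), fun s => ?_, fun s => ?_,
      fun t s => ?_, fun s => ?_, fun s => ?_, fun h0 => ?_⟩
    · exact ((hd s).sin.div_const r).congr_deriv (by field_simp)
    · refine (hd s).cos.congr_deriv ?_
      rw [show ρ = -r ^ 2 by linarith]
      field_simp
    · simp only [mul_sub, Real.sin_sub]
      ring
    · rw [show ρ = -r ^ 2 by linarith, div_pow]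
      field_simp
      linarith [Real.sin_sq_add_cos_sq (r * s)]
    · have e : Complex.sinh (r * Complex.I * s) = Complex.sin (r * s) * Complex.I := by
        rw [← Complex.sinh_mul_I]; congr 1; ring
      rcases hβ with hβ | hβ
      · rw [hβ, e]; push_cast; field_simp
      · rw [hβ, neg_mul, Complex.sinh_neg, e]; push_cast; field_simp
    · rcases hβ with hβ | hβ <;> rw [hβ] at h0 <;> simp [hr0.ne'] at h0
  · subst hρ
    have hβ : β = 0 := by simpa using h
    refine ⟨fun s => s, fun _ => 1, fun s => hasDerivAt_id s, fun s => ?_, fun t s => ?_,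
      fun s => ?_, fun s => ?_, fun _ s => rfl⟩
    · simpa using hasDerivAt_const s (1 : ℝ)
    · ring
    · ring
    · simp [hβ]
  · set r := Real.sqrt ρ with hr
    have hr0 : 0 < r := Real.sqrt_pos.2 hρ
    have hr2 : r ^ 2 = ρ := Real.sq_sqrt hρ.le
    have hrc : (r : ℂ) ≠ 0 := by exact_mod_cast hr0.ne'
    have hβ : β = r ∨ β = -r := by
      rw [← sq_eq_sq_iff_eq_or_eq_neg, h, ← Complex.ofReal_pow, hr2]
    have hd : ∀ s, HasDerivAt (fun s => r * s) r s := fun s => by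
      simpa using (hasDerivAt_id s).const_mul r
    refine ⟨fun s => Real.sinh (r * s) / r, fun s => Real.cosh (r * s), fun s => ?_, fun s => ?_,
      fun t s => ?_, fun s => ?_, fun s => ?_, fun h0 => ?_⟩
    · exact ((hd s).sinh.div_const r).congr_deriv (by field_simp)
    · refine (hd s).cosh.congr_deriv ?_
      rw [← hr2]
      field_simp
    · simp only [mul_sub, Real.sinh_sub]
      ring
    · rw [← hr2, div_pow]
      field_simp
      linarith [Real.cosh_sq (r * s)]
    · rcases hβ with hβ | hβ
      · rw [hβ]; push_cast; field_simp
      · rw [hβ, neg_mul, Complex.sinh_neg]; push_cast; field_simp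
    · rcases hβ with hβ | hβ <;> rw [hβ] at h0 <;> simp [hr0.ne'] at h0

/-- Variation of constants for `a'' + 2β a' + (β² - ρ) a = F`. -/
theorem exists_hasDerivAt_duhamel {S C F : ℝ → ℝ} {ρ β : ℝ} (hS : ∀ s, HasDerivAt S (C s) s)
    (hC : ∀ s, HasDerivAt C (ρ * S s) s) (hadd : ∀ t s, S (t - s) = S t * C s - C t * S s)
    (hpyth : ∀ s, C s ^ 2 - ρ * S s ^ 2 = 1) (hF : Continuous F) :
    ∃ a1 : ℝ → ℝ, a1 0 = 0 ∧
      (∀ t, HasDerivAt (fun t => ∫ τ in (0 : ℝ)..t, F τ * (Real.exp (-β * (t - τ)) * S (t - τ)))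
        (a1 t) t) ∧
      ∀ t, HasDerivAt a1 (F t - 2 * β * a1 t - (β ^ 2 - ρ)
        * ∫ τ in (0 : ℝ)..t, F τ * (Real.exp (-β * (t - τ)) * S (t - τ))) t := by
  have cS : Continuous S := continuous_iff_continuousAt.2 fun x => (hS x).continuousAt
  have cC : Continuous C := continuous_iff_continuousAt.2 fun x => (hC x).continuousAt
  have c1 : Continuous fun τ => F τ * Real.exp (β * τ) * C τ := by fun_prop
  have c2 : Continuous fun τ => F τ * Real.exp (β * τ) * S τ := by fun_prop
  set I1 : ℝ → ℝ := fun t => ∫ τ in (0 : ℝ)..t, F τ * Real.exp (β * τ) * C τ with hI1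
  set I2 : ℝ → ℝ := fun t => ∫ τ in (0 : ℝ)..t, F τ * Real.exp (β * τ) * S τ with hI2
  have d1 : ∀ t, HasDerivAt I1 (F t * Real.exp (β * t) * C t) t := fun t =>
    c1.integral_hasStrictDerivAt 0 t |>.hasDerivAt
  have d2 : ∀ t, HasDerivAt I2 (F t * Real.exp (β * t) * S t) t := fun t =>
    c2.integral_hasStrictDerivAt 0 t |>.hasDerivAt
  have dE : ∀ t, HasDerivAt (fun t => Real.exp (-β * t)) (-β * Real.exp (-β * t)) t := fun t =>
    (((hasDerivAt_id t).const_mul (-β)).exp).congr_deriv (by simp only [id]; ring)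
  have hEE : ∀ t, Real.exp (-β * t) * Real.exp (β * t) = 1 := fun t => by
    rw [← Real.exp_add]; simp
  -- The addition formula separates t from τ, so that only integrals with fixed integrands have to
  -- be differentiated, and no derivative under the integral sign is needed.
  have ha : (fun t => ∫ τ in (0 : ℝ)..t, F τ * (Real.exp (-β * (t - τ)) * S (t - τ)))
      = fun t => Real.exp (-β * t) * (S t * I1 t - C t * I2 t) := by
    ext t
    simp only [hI1, hI2]
    rw [← intervalIntegral.integral_const_mul, ← intervalIntegral.integral_const_mul,
      ← intervalIntegral.integral_sub (Continuous.intervalIntegrable (by fun_prop) _ _)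
      (Continuous.intervalIntegrable (by fun_prop) _ _), ← intervalIntegral.integral_const_mul]
    refine intervalIntegral.integral_congr fun τ _ => ?_
    rw [hadd, show -β * (t - τ) = -β * t + β * τ by ring, Real.exp_add]
    ring
  have ha' : ∀ t, ∫ τ in (0 : ℝ)..t, F τ * (Real.exp (-β * (t - τ)) * S (t - τ))
      = Real.exp (-β * t) * (S t * I1 t - C t * I2 t) := congrFun ha
  simp only [ha']
  refine ⟨fun t => Real.exp (-β * t) * (C t * I1 t - ρ * S t * I2 t)
    - β * (Real.exp (-β * t) * (S t * I1 t - C t * I2 t)), by simp [hI1, hI2], fun t => ?_,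
    fun t => ?_⟩
  · refine ((dE t).mul (((hS t).mul (d1 t)).sub ((hC t).mul (d2 t)))).congr_deriv ?_
    simp only [Pi.sub_apply, Pi.mul_apply]
    ring
  · have h1 := ((dE t).mul (((hC t).mul (d1 t)).sub (((hS t).const_mul ρ).mul (d2 t)))).sub
      (((dE t).mul (((hS t).mul (d1 t)).sub ((hC t).mul (d2 t)))).const_mul β)
    refine h1.congr_deriv ?_
    simp only [Pi.sub_apply, Pi.mul_apply]
    -- The terms from differentiating the integrals give F times the Wronskian C² - ρS², which
    -- equals 1.
    linear_combination (F t * Real.exp (-β * t) * Real.exp (β * t)) * hpyth t + F t * hEE t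

theorem hasDerivAt_duhamel_exp {F : ℝ → ℝ} (hF : Continuous F) (b t : ℝ) :
    HasDerivAt (fun t => ∫ τ in (0 : ℝ)..t, F τ * Real.exp (-b * (t - τ)))
      (F t - b * ∫ τ in (0 : ℝ)..t, F τ * Real.exp (-b * (t - τ))) t := by
  have c1 : Continuous fun τ => F τ * Real.exp (b * τ) := by fun_prop
  have d1 : HasDerivAt (fun t => ∫ τ in (0 : ℝ)..t, F τ * Real.exp (b * τ))
    (F t * Real.exp (b * t)) t := c1.integral_hasStrictDerivAt 0 t |>.hasDerivAt
  have dE : HasDerivAt (fun t => Real.exp (-b * t)) (-b * Real.exp (-b * t)) t :=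
    (((hasDerivAt_id t).const_mul (-b)).exp).congr_deriv (by simp only [id]; ring)
  have hEE : Real.exp (-b * t) * Real.exp (b * t) = 1 := by
    rw [← Real.exp_add]; simp
  have ha : ∀ t, ∫ τ in (0 : ℝ)..t, F τ * Real.exp (-b * (t - τ))
      = Real.exp (-b * t) * ∫ τ in (0 : ℝ)..t, F τ * Real.exp (b * τ) := by
    intro t
    rw [← intervalIntegral.integral_const_mul]
    refine intervalIntegral.integral_congr fun τ _ => ?_
    rw [show -b * (t - τ) = -b * t + b * τ by ring, Real.exp_add]
    ring
  simp only [ha]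
  refine (dE.mul d1).congr_deriv ?_
  linear_combination F t * hEE

/-- The function exp(bt)(y - Y/b) has derivative exp(bt)(f - Y) ≤ 0 on [0, R] and starts
nonpositive. -/
theorem le_of_damped {b Y R : ℝ} (hb : 0 < b) {y f : ℝ → ℝ}
    (hy : ∀ t, 0 ≤ t → HasDerivWithinAt y (f t - b * y t) (Set.Ici 0) t)
    (hf : ∀ t, 0 ≤ t → t ≤ R → f t ≤ Y) (hY : 0 ≤ Y) (h0 : y 0 = 0) {t : ℝ} (ht : 0 ≤ t)
    (htR : t ≤ R) : y t ≤ Y / b := by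
  have dE : ∀ t, HasDerivAt (fun t => Real.exp (b * t)) (b * Real.exp (b * t)) t := fun t =>
    (((hasDerivAt_id t).const_mul b).exp).congr_deriv (by simp only [id]; ring)
  have hd : ∀ t, 0 ≤ t → HasDerivWithinAt (fun t => Real.exp (b * t) * (y t - Y / b))
      (Real.exp (b * t) * (f t - Y)) (Set.Ici 0) t := fun t ht =>
    ((dE t).hasDerivWithinAt.mul ((hy t ht).sub_const _)).congr_deriv (by field_simp; ring)
  have hanti : AntitoneOn (fun t => Real.exp (b * t) * (y t - Y / b)) (Set.Icc 0 R) := by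
    refine antitoneOn_of_hasDerivWithinAt_nonpos (convex_Icc 0 R)
      (f' := fun t => Real.exp (b * t) * (f t - Y))
      (fun s hs => (hd s hs.1).continuousWithinAt.mono fun x hx => hx.1) (fun s hs => ?_)
      (fun s hs => ?_)
    · exact (hd s (interior_subset hs).1).mono fun x hx => (interior_subset hx).1
    · have hs' := interior_subset hs
      exact mul_nonpos_of_nonneg_of_nonpos (Real.exp_pos _).le
        (sub_nonpos.2 (hf s hs'.1 hs'.2))
  have h := hanti ⟨le_rfl, ht.trans htR⟩ ⟨ht, htR⟩ ht
  simp only [h0, mul_zero, Real.exp_zero, one_mul, zero_sub] at h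
  have h2 : Real.exp (b * t) * (y t - Y / b) ≤ 0 := h.trans (by
    have : 0 ≤ Y / b := by positivity
    linarith)
  have h3 := nonpos_of_mul_nonpos_right h2 (Real.exp_pos _)
  linarith

theorem abs_le_of_damped {b Y R : ℝ} (hb : 0 < b) {y f : ℝ → ℝ}
    (hy : ∀ t, 0 ≤ t → HasDerivWithinAt y (f t - b * y t) (Set.Ici 0) t)
    (hf : ∀ t, 0 ≤ t → t ≤ R → |f t| ≤ Y) (h0 : y 0 = 0) {t : ℝ} (ht : 0 ≤ t)
    (htR : t ≤ R) : |y t| ≤ Y / b := by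
  have hY : 0 ≤ Y := (abs_nonneg _).trans (hf t ht htR)
  rw [abs_le']
  refine ⟨le_of_damped hb hy (fun t h1 h2 => (le_abs_self _).trans (hf t h1 h2)) hY h0 ht htR,
    le_of_damped (y := fun t => -y t) (f := fun t => -f t) hb (fun t h1 => ?_)
      (fun t h1 h2 => (neg_le_abs _).trans (hf t h1 h2)) hY (by simp [h0]) ht htR⟩
  exact (hy t h1).neg.congr_deriv (by ring)

/-- The energy estimate for `a'' + b a' + c a = κ (s + τ s')`; the derivative of `s` is absorbed
into the momentum. -/
theorem energy_le {a a1 s s1 : ℝ → ℝ} {b c κ τ : ℝ} (hb : 0 < b) (hc : 0 < c)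
    (ha : ∀ t, 0 ≤ t → HasDerivWithinAt a (a1 t) (Set.Ici 0) t)
    (ha1 : ∀ t, 0 ≤ t → HasDerivWithinAt a1 (κ * (s t + τ * s1 t) - b * a1 t - c * a t)
      (Set.Ici 0) t)
    (hs : ∀ t, HasDerivAt s (s1 t) t) (hs1 : ∀ t, |s t| ≤ 1) (h0 : a 0 = 0) (h10 : a1 0 = 0)
    {t : ℝ} (ht : 0 ≤ t) :
    (a1 t + b * a t - κ * τ * s t) ^ 2 + c * a t ^ 2 + κ ^ 2 * (1 + c / b * τ ^ 2 / 2)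
      ≤ Real.exp t * ((κ * τ) ^ 2 + κ ^ 2 * (1 + c / b * τ ^ 2 / 2)) := by
  set K := κ ^ 2 * (1 + c / b * τ ^ 2 / 2) with hK
  set f : ℝ → ℝ := fun t => Real.exp (-t)
    * ((a1 t + b * a t - κ * τ * s t) ^ 2 + c * a t ^ 2 + K) with hf
  have dE : ∀ t, HasDerivAt (fun t => Real.exp (-t)) (-Real.exp (-t)) t := fun t =>
    ((hasDerivAt_neg t).exp).congr_deriv (by ring)
  -- For the momentum v = a' + b a - κτs the equation reads v' = κs - ca, free of s'. The energy is
  -- v² + ca² + K, and the claim is that its derivative is at most itself.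
  have hd : ∀ t, 0 ≤ t → HasDerivWithinAt f (Real.exp (-t)
      * (2 * (a1 t + b * a t - κ * τ * s t) * (κ * s t - c * a t) + 2 * c * a t * a1 t
        - ((a1 t + b * a t - κ * τ * s t) ^ 2 + c * a t ^ 2 + K))) (Set.Ici 0) t := by
    intro t ht
    have hv := ((ha1 t ht).add ((ha t ht).const_mul b)).sub
      ((hs t).hasDerivWithinAt.const_mul (κ * τ)) (s := Set.Ici 0)
    have hE := ((hv.pow 2).add (((ha t ht).pow 2).const_mul c)).add_const K
    refine ((dE t).hasDerivWithinAt.mul hE).congr_deriv ?_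
    simp only [Pi.add_apply, Pi.sub_apply, Pi.pow_apply]
    push_cast
    ring
  have hanti : AntitoneOn f (Set.Ici 0) := by
    refine antitoneOn_of_hasDerivWithinAt_nonpos (convex_Ici 0)
      (fun s hs => (hd s hs).continuousWithinAt)
      (fun s hs => (hd s (interior_subset hs)).mono interior_subset) (fun t _ => ?_)
    refine mul_nonpos_of_nonneg_of_nonpos (Real.exp_pos _).le ?_
    have e1 : s t ^ 2 ≤ 1 := (sq_le_one_iff_abs_le_one _).2 (hs1 t)
    set v := a1 t + b * a t - κ * τ * s t with hv
    have e2 : a1 t = v - b * a t + κ * τ * s t := by rw [hv]; ring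
    -- In the energy derivative the cross terms in av cancel. Completing this square bounds 2caκτs -
    -- 2cba² by (c/b)κ²τ²s²/2, while 2κsv ≤ κ²s² + v². This dictates the choice of K.
    have e3 : 0 ≤ c / (2 * b) * (2 * b * a t - κ * τ * s t) ^ 2 := by positivity
    have e4 : c / (2 * b) * (2 * b * a t - κ * τ * s t) ^ 2 = 2 * c * b * a t ^ 2
      - 2 * c * a t * κ * τ * s t + c / b * τ ^ 2 / 2 * κ ^ 2 * s t ^ 2 := by field_simp; ring
    have e5 : (κ ^ 2 + c / b * τ ^ 2 / 2 * κ ^ 2) * s t ^ 2 ≤ K := by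
      rw [hK]
      have : 0 ≤ κ ^ 2 + c / b * τ ^ 2 / 2 * κ ^ 2 := by positivity
      nlinarith
    have e6 : 0 ≤ c * a t ^ 2 := by positivity
    rw [e2]
    nlinarith [sq_nonneg (κ * s t - v)]
  have h := hanti (Set.mem_Ici.2 le_rfl) ht ht
  simp only [hf, h0, h10, neg_zero, Real.exp_zero, mul_zero, add_zero, zero_sub, one_mul] at h
  have e1 : s 0 ^ 2 ≤ 1 := (sq_le_one_iff_abs_le_one _).2 (hs1 0)
  have h2 : (-(κ * τ * s 0)) ^ 2 + c * 0 ^ 2 + K ≤ (κ * τ) ^ 2 + K := by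
    nlinarith [sq_nonneg (κ * τ)]
  have h3 := mul_le_mul_of_nonneg_left (h.trans h2) (Real.exp_pos t).le
  rwa [← mul_assoc, ← Real.exp_add, add_neg_cancel, Real.exp_zero, one_mul] at h3

/-- The difference solves the homogeneous equation with zero data, so `energy_le` with κ = 0 makes
its energy vanish. -/
theorem damped_unique {a ā a1 ā1 F : ℝ → ℝ} {b c : ℝ} (hb : 0 < b) (hc : 0 < c)
    (ha : ∀ t, 0 ≤ t → HasDerivWithinAt a (a1 t) (Set.Ici 0) t)
    (ha1 : ∀ t, 0 ≤ t → HasDerivWithinAt a1 (F t - b * a1 t - c * a t) (Set.Ici 0) t)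
    (hā : ∀ t, 0 ≤ t → HasDerivWithinAt ā (ā1 t) (Set.Ici 0) t)
    (hā1 : ∀ t, 0 ≤ t → HasDerivWithinAt ā1 (F t - b * ā1 t - c * ā t) (Set.Ici 0) t)
    (h0 : a 0 = ā 0) (h10 : a1 0 = ā1 0) {t : ℝ} (ht : 0 ≤ t) : a t = ā t := by
  have h := energy_le (a := fun t => a t - ā t) (a1 := fun t => a1 t - ā1 t) (s := fun _ => 0)
    (s1 := fun _ => 0) (κ := 0) (τ := 0) hb hc (fun t ht => (ha t ht).sub (hā t ht))
    (fun t ht => ((ha1 t ht).sub (hā1 t ht)).congr_deriv (by ring))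
    (fun t => hasDerivAt_const t 0) (by simp) (by simp [h0]) (by simp [h10]) ht
  simp only [mul_zero, sub_zero, ne_eq, OfNat.ofNat_ne_zero, not_false_eq_true, zero_pow, zero_mul,
    add_zero] at h
  have h1 : c * (a t - ā t) ^ 2 ≤ 0 := by
    nlinarith [sq_nonneg (a1 t - ā1 t + b * (a t - ā t))]
  have h2 : (a t - ā t) ^ 2 ≤ 0 := nonpos_of_mul_nonpos_right h1 hc
  have h3 : a t - ā t = 0 := pow_eq_zero_iff (two_ne_zero) |>.1 (le_antisymm h2 (sq_nonneg _))
  linarith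

/-- A bound for `a` and `a'` on `[0, R]` that depends on the coefficients through `c / b` only,
apart from a gain of `1 / b` for `a`. -/
theorem damped_bounds {a a1 s s1 : ℝ → ℝ} {b c κ τ G R : ℝ} (hb : 0 < b) (hc : 0 < c)
    (hG : c / b ≤ G)
    (ha : ∀ t, 0 ≤ t → HasDerivWithinAt a (a1 t) (Set.Ici 0) t)
    (ha1 : ∀ t, 0 ≤ t → HasDerivWithinAt a1 (κ * (s t + τ * s1 t) - b * a1 t - c * a t)
      (Set.Ici 0) t)
    (hs : ∀ t, HasDerivAt s (s1 t) t) (hs1 : ∀ t, |s t| ≤ 1) (h0 : a 0 = 0) (h10 : a1 0 = 0)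
    {t : ℝ} (ht : 0 ≤ t) (htR : t ≤ R) :
    |a t| ≤ (1 + Real.exp R * ((κ * τ) ^ 2 + κ ^ 2 * (1 + G * τ ^ 2 / 2)) + |κ * τ|) / b ∧
    |a1 t| ≤ 2 * (1 + Real.exp R * ((κ * τ) ^ 2 + κ ^ 2 * (1 + G * τ ^ 2 / 2)) + |κ * τ|) := by
  set X := Real.exp R * ((κ * τ) ^ 2 + κ ^ 2 * (1 + G * τ ^ 2 / 2)) with hX
  have hf : ∀ t, 0 ≤ t → t ≤ R → |a1 t + b * a t| ≤ 1 + X + |κ * τ| := by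
    intro t ht htR
    have h := energy_le hb hc ha ha1 hs hs1 h0 h10 ht
    have h1 : (a1 t + b * a t - κ * τ * s t) ^ 2 ≤ X := by
      have e1 : 0 ≤ c * a t ^ 2 := by positivity
      have e2 : 0 ≤ κ ^ 2 * (1 + c / b * τ ^ 2 / 2) := by positivity
      calc _ ≤ Real.exp t * ((κ * τ) ^ 2 + κ ^ 2 * (1 + c / b * τ ^ 2 / 2)) := by linarith
        _ ≤ X := by rw [hX]; gcongr
    -- The crude bound |x| ≤ 1 + x² avoids a square root in the constants.
    have h2 : |a1 t + b * a t - κ * τ * s t| ≤ 1 + X := by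
      rw [← sq_abs] at h1
      nlinarith [sq_nonneg (|a1 t + b * a t - κ * τ * s t| - 1)]
    have h3 : |κ * τ * s t| ≤ |κ * τ| := by
      rw [abs_mul]
      exact mul_le_of_le_one_right (abs_nonneg _) (hs1 t)
    calc |a1 t + b * a t| = |(a1 t + b * a t - κ * τ * s t) + κ * τ * s t| := by ring_nf
      _ ≤ _ := (abs_add_le _ _).trans (add_le_add h2 h3)
  -- Reading a' = (a' + ba) - ba as a damped first-order equation with bounded forcing gains the
  -- factor 1/b.
  have hab : |a t| ≤ (1 + X + |κ * τ|) / b :=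
    abs_le_of_damped (f := fun t => a1 t + b * a t) hb
      (fun t ht => (ha t ht).congr_deriv (by ring)) hf h0 ht htR
  refine ⟨hab, ?_⟩
  have h1 := hf t ht htR
  rw [le_div_iff₀ hb] at hab
  calc |a1 t| = |(a1 t + b * a t) - b * a t| := by ring_nf
    _ ≤ |a1 t + b * a t| + |b * a t| := abs_sub _ _
    _ ≤ (1 + X + |κ * τ|) + (1 + X + |κ * τ|) := by
        gcongr
        rw [abs_mul, abs_of_pos hb, mul_comm]
        exact hab
    _ = _ := by ring

/-! ### Calculus on the half-line -/

theorem continuousOn_tsum_Ici {ι : Type*} {f : ι → ℝ → ℝ}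
    (hc : ∀ i, ContinuousOn (f i) (Set.Ici 0))
    (hb : ∀ R, ∃ u : ι → ℝ, Summable u ∧ ∀ i t, 0 ≤ t → t ≤ R → |f i t| ≤ u i) :
    ContinuousOn (fun t => ∑' i, f i t) (Set.Ici 0) := by
  intro t ht
  obtain ⟨u, hu, hbd⟩ := hb (t + 1)
  have h := continuousOn_tsum (s := Set.Icc 0 (t + 1))
    (fun i => (hc i).mono Set.Icc_subset_Ici_self) hu (fun i x hx => hbd i x hx.1 hx.2)
  refine (h t ⟨ht, by linarith⟩).mono_of_mem_nhdsWithin ?_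
  rw [← Set.Ici_inter_Iic]
  exact inter_mem_nhdsWithin _ (Iic_mem_nhds (by linarith))

/-- To obtain the one-sided derivative at 0 from termwise differentiation on an open interval, each
derivative is extended to negative times by its value at 0 and then integrated; the primitives agree
with the original terms on [0, ∞). -/
theorem hasDerivWithinAt_tsum_Ici {ι : Type*} {f f' : ι → ℝ → ℝ}
    (hf : ∀ i t, 0 ≤ t → HasDerivWithinAt (f i) (f' i t) (Set.Ici 0) t)
    (hc : ∀ i, ContinuousOn (f' i) (Set.Ici 0))
    (hb : ∀ R, ∃ u : ι → ℝ, Summable u ∧ ∀ i t, 0 ≤ t → t ≤ R → |f' i t| ≤ u i)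
    (h0 : Summable fun i => f i 0) {t : ℝ} (ht : 0 ≤ t) :
    HasDerivWithinAt (fun t => ∑' i, f i t) (∑' i, f' i t) (Set.Ici 0) t := by
  obtain ⟨u, hu, hbd⟩ := hb (t + 1)
  have hg : ∀ i, Continuous fun s => f' i (max s 0) := fun i =>
    (hc i).comp_continuous (by fun_prop) fun s => le_max_right s 0
  have hF : ∀ i s, HasDerivAt (fun s => f i 0 + ∫ r in (0 : ℝ)..s, f' i (max r 0))
      (f' i (max s 0)) s := fun i s =>
    ((hg i).integral_hasStrictDerivAt 0 s).hasDerivAt.const_add _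
  have hFe : ∀ i s, 0 ≤ s → f i 0 + ∫ r in (0 : ℝ)..s, f' i (max r 0) = f i s := by
    intro i s hs
    rw [intervalIntegral.integral_eq_sub_of_hasDeriv_right_of_le hs (f := f i)
      (fun r hr => (hf i r hr.1).continuousWithinAt.mono Set.Icc_subset_Ici_self)
      (fun r hr => ?_) ((hg i).intervalIntegrable _ _)]
    · ring
    · simp only [max_eq_left hr.1.le]
      exact (hf i r hr.1.le).mono fun x hx => hr.1.le.trans (le_of_lt hx)
  have hbd0 : ∀ i s, s ∈ Set.Iio (t + 1) → ‖f' i (max s 0)‖ ≤ u i := fun i s hs =>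
    hbd i _ (le_max_right _ _) (max_le (le_of_lt hs) (by linarith))
  have hd := hasDerivAt_tsum_of_isPreconnected hu isOpen_Iio isPreconnected_Iio
    (fun i s _ => hF i s) hbd0 (y₀ := 0) (y := t) (by simp; linarith) (by simpa using h0) (by simp)
  rw [max_eq_left ht] at hd
  refine hd.hasDerivWithinAt.congr (fun s hs => tsum_congr fun i => (hFe i s hs).symm)
    (tsum_congr fun i => (hFe i t ht).symm)

theorem derivWithin_Ici {g : ℝ → ℝ} {g' t : ℝ} (ht : 0 ≤ t)
    (h : HasDerivWithinAt g g' (Set.Ici 0) t) : derivWithin g (Set.Ici 0) t = g' :=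
  h.derivWithin (uniqueDiffOn_Ici 0 t ht)

theorem contDiffOn_one_Ici {g g1 : ℝ → ℝ}
    (hg : ∀ t, 0 ≤ t → HasDerivWithinAt g (g1 t) (Set.Ici 0) t)
    (hc : ContinuousOn g1 (Set.Ici 0)) : ContDiffOn ℝ 1 g (Set.Ici 0) := by
  rw [show (1 : WithTop ℕ∞) = 0 + 1 by simp, contDiffOn_succ_iff_derivWithin (uniqueDiffOn_Ici 0)]
  refine ⟨fun t ht => (hg t ht).differentiableWithinAt, by simp, ?_⟩
  rw [contDiffOn_zero]
  exact hc.congr fun t ht => derivWithin_Ici ht (hg t ht)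

theorem contDiffOn_two_Ici {g g1 g2 : ℝ → ℝ}
    (hg : ∀ t, 0 ≤ t → HasDerivWithinAt g (g1 t) (Set.Ici 0) t)
    (hg1 : ∀ t, 0 ≤ t → HasDerivWithinAt g1 (g2 t) (Set.Ici 0) t)
    (hc : ContinuousOn g2 (Set.Ici 0)) : ContDiffOn ℝ 2 g (Set.Ici 0) := by
  rw [show (2 : WithTop ℕ∞) = 1 + 1 by norm_num,
    contDiffOn_succ_iff_derivWithin (uniqueDiffOn_Ici 0)]
  refine ⟨fun t ht => (hg t ht).differentiableWithinAt, by simp, ?_⟩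
  exact (contDiffOn_one_Ici hg1 hc).congr fun t ht => derivWithin_Ici ht (hg t ht)

theorem iteratedDerivWithin_two_Ici {g g1 : ℝ → ℝ} {g2 t : ℝ}
    (hg : ∀ t, 0 ≤ t → HasDerivWithinAt g (g1 t) (Set.Ici 0) t) (ht : 0 ≤ t)
    (hg1 : HasDerivWithinAt g1 g2 (Set.Ici 0) t) :
    iteratedDerivWithin 2 g (Set.Ici 0) t = g2 := by
  rw [show 2 = 1 + 1 from rfl, iteratedDerivWithin_succ]
  refine derivWithin_Ici ht (hg1.congr (fun s hs => ?_) ?_)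
  · rw [iteratedDerivWithin_one]; exact derivWithin_Ici hs (hg s hs)
  · rw [iteratedDerivWithin_one]; exact derivWithin_Ici ht (hg t ht)

theorem ContDiffOn.hasDerivWithinAt_Ici {g : ℝ → ℝ} (h : ContDiffOn ℝ 1 g (Set.Ici 0)) {t : ℝ}
    (ht : 0 ≤ t) : HasDerivWithinAt g (derivWithin g (Set.Ici 0) t) (Set.Ici 0) t :=
  (h.differentiableOn (by simp) t ht).hasDerivWithinAt

theorem ContDiffOn.hasDerivWithinAt_derivWithin_Ici {g : ℝ → ℝ}
    (h : ContDiffOn ℝ 2 g (Set.Ici 0)) {t : ℝ} (ht : 0 ≤ t) :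
    HasDerivWithinAt (derivWithin g (Set.Ici 0)) (iteratedDerivWithin 2 g (Set.Ici 0) t)
      (Set.Ici 0) t := by
  rw [show (2 : WithTop ℕ∞) = 1 + 1 by norm_num,
    contDiffOn_succ_iff_derivWithin (uniqueDiffOn_Ici 0)] at h
  have h1 := h.2.2.hasDerivWithinAt_Ici ht
  rw [show 2 = 1 + 1 from rfl, iteratedDerivWithin_succ]
  convert h1 using 1
  refine derivWithin_congr (fun s _ => ?_) ?_ <;> rw [iteratedDerivWithin_one]

/-! ### The source seen by a single mode -/

theorem hasDerivAt_xBar (L A w t : ℝ) :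
    HasDerivAt (xBar L A w) (-(A * w * Real.sin (w * t))) t :=
  ((((hasDerivAt_id t).const_mul w).cos.const_mul A).const_add (L / 2)).congr_deriv
    (by simp only [id]; ring)

theorem hasDerivAt_yBar (H B w t : ℝ) :
    HasDerivAt (yBar H B w) (B * w * Real.cos (w * t)) t :=
  ((((hasDerivAt_id t).const_mul w).sin.const_mul B).const_add (H / 2)).congr_deriv
    (by simp only [id]; ring)

/-- The value of the sine mode `q` at the source. -/
def sourceMode (L H A B w : ℝ) (q : ℕ × ℕ) (t : ℝ) : ℝ :=
  sineMode L H (q.1 + 1) (q.2 + 1) (xBar L A w t, yBar H B w t)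

/-- The time derivative of `sourceMode`. -/
def sourceModeDeriv (L H A B w : ℝ) (q : ℕ × ℕ) (t : ℝ) : ℝ :=
  freq L (q.1 + 1) * -(A * w * Real.sin (w * t))
      * Real.cos (freq L (q.1 + 1) * xBar L A w t) * Real.sin (freq H (q.2 + 1) * yBar H B w t)
    + freq H (q.2 + 1) * (B * w * Real.cos (w * t))
      * Real.sin (freq L (q.1 + 1) * xBar L A w t) * Real.cos (freq H (q.2 + 1) * yBar H B w t)

theorem hasDerivAt_sourceMode (L H A B w : ℝ) (q : ℕ × ℕ) (t : ℝ) :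
    HasDerivAt (sourceMode L H A B w q) (sourceModeDeriv L H A B w q t) t :=
  (((hasDerivAt_xBar L A w t).const_mul (freq L (q.1 + 1))).sin.mul
    ((hasDerivAt_yBar H B w t).const_mul (freq H (q.2 + 1))).sin).congr_deriv (by
      simp only [sourceModeDeriv]; ring)

theorem continuous_xBar (L A w : ℝ) : Continuous (xBar L A w) :=
  continuous_iff_continuousAt.2 fun t => (hasDerivAt_xBar L A w t).continuousAt

theorem continuous_yBar (H B w : ℝ) : Continuous (yBar H B w) :=
  continuous_iff_continuousAt.2 fun t => (hasDerivAt_yBar H B w t).continuousAt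

theorem continuous_sourceMode (L H A B w : ℝ) (q : ℕ × ℕ) :
    Continuous (sourceMode L H A B w q) :=
  continuous_iff_continuousAt.2 fun t => (hasDerivAt_sourceMode L H A B w q t).continuousAt

theorem continuous_sourceModeDeriv (L H A B w : ℝ) (q : ℕ × ℕ) :
    Continuous (sourceModeDeriv L H A B w q) := by
  have h1 := continuous_xBar L A w
  have h2 := continuous_yBar H B w
  unfold sourceModeDeriv
  fun_prop

/-- By the chain rule along the trajectory, the integrand of Pₘₙ is the combination s + τq s' coming
from Q + τq ∂ₜQ. -/
theorem sourceFactor_eq (L H τq A B w : ℝ) (q : ℕ × ℕ) (t : ℝ) :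
    sourceFactor L H τq A B w (q.1 + 1) (q.2 + 1) t
      = sourceMode L H A B w q t + τq * sourceModeDeriv L H A B w q t := by
  rw [sourceFactor, (hasDerivAt_xBar L A w t).deriv, (hasDerivAt_yBar H B w t).deriv,
    sourceMode, sourceModeDeriv, sineMode]
  ring

theorem abs_sourceMode_le (L H A B w : ℝ) (q : ℕ × ℕ) (t : ℝ) : |sourceMode L H A B w q t| ≤ 1 :=
  abs_sineMode_le ..

theorem abs_sourceModeDeriv_le {L H : ℝ} (hL : 0 < L) (hH : 0 < H) (A B w : ℝ) (q : ℕ × ℕ)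
    (t : ℝ) : |sourceModeDeriv L H A B w q t|
      ≤ freqConst L H * (|A * w| + |B * w|) * modeWeight q := by
  have key : ∀ {μ a x y z : ℝ}, 0 ≤ μ → μ ≤ freqConst L H * modeWeight q → |x| ≤ 1 → |y| ≤ 1 →
      |z| ≤ 1 → |μ * (a * x) * y * z| ≤ freqConst L H * modeWeight q * |a| := by
    intro μ a x y z h0 hμ hx hy hz
    generalize freqConst L H * modeWeight q = Z at hμ ⊢
    have hZ := h0.trans hμ
    simp only [abs_mul, abs_of_nonneg h0]
    calc μ * (|a| * |x|) * |y| * |z| ≤ Z * (|a| * 1) * 1 * 1 := by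
          gcongr
      _ = _ := by ring
  have h1 := key (a := -(A * w)) (freq_pos hL q.1).le (freq_left_le hL hH q)
    (Real.abs_sin_le_one (w * t)) (Real.abs_cos_le_one (freq L (q.1 + 1) * xBar L A w t))
    (Real.abs_sin_le_one (freq H (q.2 + 1) * yBar H B w t))
  have h2 := key (a := B * w) (freq_pos hH q.2).le (freq_right_le hL hH q)
    (Real.abs_cos_le_one (w * t)) (Real.abs_sin_le_one (freq L (q.1 + 1) * xBar L A w t))
    (Real.abs_cos_le_one (freq H (q.2 + 1) * yBar H B w t))
  rw [abs_neg, neg_mul] at h1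
  rw [sourceModeDeriv]
  refine (abs_add_le _ _).trans ((add_le_add h1 h2).trans (le_of_eq ?_))
  ring

theorem hasSum_heatSource {L H : ℝ} (hL : 0 < L) (hH : 0 < H) (Θ A B w t : ℝ)
    (φ : DirichletTest L H) :
    HasSum (fun q => Θ * (4 / (L * H) * sineCoeff L H q φ * sourceMode L H A B w q t))
      (heatSource L H Θ A B w t φ) :=
  (hasSum_sineMode hL hH φ.2 _).mul_left Θ

theorem hasSum_deriv_heatSource {L H : ℝ} (hL : 0 < L) (hH : 0 < H) (Θ A B w t : ℝ)
    (φ : DirichletTest L H) :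
    HasSum (fun q => Θ * (4 / (L * H) * sineCoeff L H q φ * sourceModeDeriv L H A B w q t))
      (deriv (fun s => heatSource L H Θ A B w s φ) t) := by
  have hu : Summable fun q => |Θ| * (4 / (L * H)) * (freqConst L H * (|A * w| + |B * w|))
      * (|sineCoeff L H q φ| * modeWeight q ^ 1) := (summable_sineCoeff hL hH φ.2 1).mul_left _
  have hbd : ∀ q t, ‖Θ * (4 / (L * H) * sineCoeff L H q φ * sourceModeDeriv L H A B w q t)‖
      ≤ |Θ| * (4 / (L * H)) * (freqConst L H * (|A * w| + |B * w|))
      * (|sineCoeff L H q φ| * modeWeight q ^ 1) := fun q t => by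
    have h := abs_sourceModeDeriv_le hL hH A B w q t
    rw [Real.norm_eq_abs, abs_mul, abs_mul, abs_mul,
      abs_of_nonneg (by positivity : 0 ≤ 4 / (L * H))]
    calc _ ≤ |Θ| * (4 / (L * H) * |sineCoeff L H q φ|
            * (freqConst L H * (|A * w| + |B * w|) * modeWeight q)) := by gcongr
      _ = _ := by ring
  have hd := hasDerivAt_tsum hu (fun q s => ((hasDerivAt_sourceMode L H A B w q s).const_mul
    (4 / (L * H) * sineCoeff L H q φ)).const_mul Θ) hbd
    (hasSum_heatSource hL hH Θ A B w t φ).summable t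
  have e : (fun s => ∑' q, Θ * (4 / (L * H) * sineCoeff L H q φ * sourceMode L H A B w q s))
      = fun s => heatSource L H Θ A B w s φ :=
    funext fun s => (hasSum_heatSource hL hH Θ A B w s φ).tsum_eq
  rw [e] at hd
  rw [hd.deriv]
  exact (Summable.of_norm_bounded hu fun q => hbd q t).hasSum

theorem lambdaSq_pos {L : ℝ} (hL : 0 < L) (H : ℝ) (q : ℕ × ℕ) :
    0 < lambdaSq L H (q.1 + 1) (q.2 + 1) := by
  have := freq_pos hL q.1
  unfold lambdaSq
  positivity

theorem lambdaSq_le {L H : ℝ} (hL : 0 < L) (hH : 0 < H) (q : ℕ × ℕ) :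
    lambdaSq L H (q.1 + 1) (q.2 + 1) ≤ 2 * freqConst L H ^ 2 * modeWeight q ^ 2 := by
  have h1 := pow_le_pow_left₀ (freq_pos hL q.1).le (freq_left_le hL hH q) 2
  have h2 := pow_le_pow_left₀ (freq_pos hH q.2).le (freq_right_le hL hH q) 2
  rw [mul_pow] at h1 h2
  rw [lambdaSq]
  linarith

/-- The inequality μ² + γ² ≥ 2μγ converts decay in λ² into decay in the product mn, which is
square-summable. -/
theorem le_lambdaSq {L H : ℝ} (hL : 0 < L) (hH : 0 < H) (q : ℕ × ℕ) :
    2 * (Real.pi ^ 2 / (L * H)) * modeWeight q ≤ lambdaSq L H (q.1 + 1) (q.2 + 1) := by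
  rw [mul_assoc, ← freq_mul_freq hL hH, lambdaSq]
  nlinarith [sq_nonneg (freq L (q.1 + 1) - freq H (q.2 + 1))]

theorem isDistribSineSeries_ofReal {L H : ℝ} {c : ℕ → ℕ → ℂ} {a : ℕ × ℕ → ℝ}
    (h : ∀ q, (a q : ℂ) = c (q.1 + 1) (q.2 + 1)) {T : DirichletDistribution L H} :
    IsDistribSineSeries L H c T ↔
      ∀ φ : DirichletTest L H, HasSum (fun q => a q * sineCoeff L H q φ) (T φ) := by
  refine forall_congr' fun φ => ?_
  rw [← Complex.hasSum_ofReal]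
  simp only [← h, Complex.ofReal_mul]
  rfl

/-! ### The modes of the dual-phase-lag equation -/

/-- The square is real and forgets the branch; it is the parameter ρ of `exists_fundamental_pair`.
-/
theorem beta2_sq {L H α τq τT : ℝ} (hτ : 0 < τq) (m n : ℕ) :
    beta2 L H α τq τT m n ^ 2 = (((1 + α * τT * lambdaSq L H m n) ^ 2
      - 4 * α * τq * lambdaSq L H m n) / (4 * τq ^ 2) : ℝ) := by
  have hc : (τq : ℂ) ≠ 0 := by exact_mod_cast hτ.ne'
  rw [beta2, div_pow, ← Complex.cpow_mul_nat]
  have : (1 / 2 : ℂ) * (2 : ℕ) = 1 := by norm_num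
  rw [this, Complex.cpow_one]
  push_cast
  ring

/-- The coefficients of the series are real and solve the scalar dual-phase-lag equations. -/
theorem exists_dplMode {L H α k τq : ℝ} (hL : 0 < L) (hH : 0 < H) (hk : 0 < k) (hτ : 0 < τq)
    (τT Θ A B w : ℝ) (q : ℕ × ℕ) :
    ∃ a a1 : ℝ → ℝ, (∀ t, (a t : ℂ) = dplCoeff L H α k τq τT Θ A B w (q.1 + 1) (q.2 + 1) t) ∧
      a 0 = 0 ∧ a1 0 = 0 ∧ (∀ t, HasDerivAt a (a1 t) t) ∧
      ∀ t, HasDerivAt a1 (4 * α * Θ / (L * H * τq * k)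
          * (sourceMode L H A B w q t + τq * sourceModeDeriv L H A B w q t)
        - (1 + α * τT * lambdaSq L H (q.1 + 1) (q.2 + 1)) / τq * a1 t
        - α * lambdaSq L H (q.1 + 1) (q.2 + 1) / τq * a t) t := by
  set Λ := lambdaSq L H (q.1 + 1) (q.2 + 1) with hΛ
  set κ := 4 * α * Θ / (L * H * τq * k) with hκ
  set β := beta1 L H α τq τT (q.1 + 1) (q.2 + 1) with hβ
  set β2 := beta2 L H α τq τT (q.1 + 1) (q.2 + 1) with hβ2
  obtain ⟨S, C, hS, hC, hadd, hpyth, hsinh, hlin⟩ :=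
    exists_fundamental_pair (beta2_sq (L := L) (H := H) (α := α) (τT := τT) hτ (q.1 + 1) (q.2 + 1))
  set F : ℝ → ℝ := fun t => sourceMode L H A B w q t + τq * sourceModeDeriv L H A B w q t with hF
  have cF : Continuous F :=
    (continuous_sourceMode L H A B w q).add ((continuous_sourceModeDeriv L H A B w q).const_mul τq)
  have hFs : ∀ t, sourceFactor L H τq A B w (q.1 + 1) (q.2 + 1) t = F t :=
    sourceFactor_eq L H τq A B w q
  obtain ⟨a1, h10, ha, ha1⟩ := exists_hasDerivAt_duhamel (β := β) hS hC hadd hpyth cF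
  refine ⟨fun t => κ * ∫ τ in (0 : ℝ)..t, F τ * (Real.exp (-β * (t - τ)) * S (t - τ)),
    fun t => κ * a1 t, fun t => ?_, by simp, by simp [h10], fun t => (ha t).const_mul κ,
    fun t => ((ha1 t).const_mul κ).congr_deriv ?_⟩
  · have hLc : (L : ℂ) ≠ 0 := by exact_mod_cast hL.ne'
    have hHc : (H : ℂ) ≠ 0 := by exact_mod_cast hH.ne'
    have hkc : (k : ℂ) ≠ 0 := by exact_mod_cast hk.ne'
    have hτc : (τq : ℂ) ≠ 0 := by exact_mod_cast hτ.ne'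
    rw [dplCoeff, ← hβ2]
    split_ifs with h0
    · rw [Complex.ofReal_mul, ← intervalIntegral.integral_ofReal, hκ]
      push_cast
      congr 1
      refine intervalIntegral.integral_congr fun τ _ => ?_
      rw [hFs, hlin h0, ← hβ]
      push_cast
      ring
    · have e : dplP L H α τq τT A B w (q.1 + 1) (q.2 + 1) t = β2
          * ((∫ τ in (0 : ℝ)..t, F τ * (Real.exp (-β * (t - τ)) * S (t - τ)) : ℝ) : ℂ) := by
        rw [dplP, ← intervalIntegral.integral_ofReal, ← intervalIntegral.integral_const_mul]
        refine intervalIntegral.integral_congr fun τ _ => ?_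
        have := hsinh (t - τ)
        rw [Complex.ofReal_sub] at this
        rw [hFs, this, ← hβ, ← hβ2]
        push_cast
        ring
      rw [e, hκ]
      push_cast
      field_simp
  -- Here 2β₁ = (1 + ατTΛ)/τq and β₁² - β₂² = αΛ/τq match the coefficients of the equation.
  · rw [hβ, beta1, ← hΛ]
    field_simp
    ring

/-- Since b ≥ 1/τq, the ratio c/b is O(weight²), so `damped_bounds` gives O(weight²) for a and a'.
The equation then gives a'' another factor λ² = O(weight²), whence the exponent 4. -/
theorem dplMode_bound {L H α τq τT κ A B w R : ℝ} (hL : 0 < L) (hH : 0 < H) (hα : 0 < α)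
    (hτ : 0 < τq) (hT : 0 ≤ τT) {a a1 : ℕ × ℕ → ℝ → ℝ} (h0 : ∀ q, a q 0 = 0)
    (h10 : ∀ q, a1 q 0 = 0) (ha : ∀ q t, HasDerivAt (a q) (a1 q t) t)
    (ha1 : ∀ q t, HasDerivAt (a1 q) (κ
          * (sourceMode L H A B w q t + τq * sourceModeDeriv L H A B w q t)
        - (1 + α * τT * lambdaSq L H (q.1 + 1) (q.2 + 1)) / τq * a1 q t
        - α * lambdaSq L H (q.1 + 1) (q.2 + 1) / τq * a q t) t) :
    ∃ C : ℝ, ∀ q t, 0 ≤ t → t ≤ R → |a q t| ≤ C * modeWeight q ^ 4 ∧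
      |a1 q t| ≤ C * modeWeight q ^ 4 ∧
      |κ * (sourceMode L H A B w q t + τq * sourceModeDeriv L H A B w q t)
        - (1 + α * τT * lambdaSq L H (q.1 + 1) (q.2 + 1)) / τq * a1 q t
        - α * lambdaSq L H (q.1 + 1) (q.2 + 1) / τq * a q t| ≤ C * modeWeight q ^ 4 := by
  set D := 2 * freqConst L H ^ 2 with hD
  set D1 := freqConst L H * (|A * w| + |B * w|) with hD1
  have hf := one_le_freqConst hL hH
  set Y := 1 + Real.exp R * ((κ * τq) ^ 2 + κ ^ 2 * (1 + α * D * τq ^ 2 / 2)) + |κ * τq| with hY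
  have hY0 : 0 ≤ Y := by positivity
  have hD0 : 0 ≤ D := by positivity
  have hD10 : 0 ≤ D1 := by positivity
  set b0 := (1 + α * τT * D) / τq with hb0
  have hb00 : 0 ≤ b0 := by positivity
  refine ⟨τq * Y + 2 * Y + (|κ| * (1 + τq * D1) + b0 * (2 * Y) + α * D / τq * (τq * Y)),
    fun q t ht htR => ?_⟩
  have hν := one_le_modeWeight q
  have hν0 := modeWeight_pos q
  have hΛ0 := lambdaSq_pos hL H q
  have hΛ := lambdaSq_le hL hH q
  have hs1 := abs_sourceModeDeriv_le hL hH A B w q t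
  have hs := abs_sourceMode_le L H A B w q t
  rw [← hD] at hΛ
  rw [← hD1] at hs1
  set Λ := lambdaSq L H (q.1 + 1) (q.2 + 1)
  set ν := modeWeight q
  have hν2 : 1 ≤ ν ^ 2 := one_le_pow₀ hν
  have hb : 0 < (1 + α * τT * Λ) / τq := by positivity
  have hcb : α * Λ / τq / ((1 + α * τT * Λ) / τq) ≤ α * D * ν ^ 2 := by
    rw [div_div_div_cancel_right₀ hτ.ne']
    refine (div_le_self (by positivity) ?_).trans ?_
    · have : 0 ≤ α * τT * Λ := by positivity
      linarith
    · rw [mul_assoc]; gcongr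
  obtain ⟨e1, e2⟩ := damped_bounds (R := R) hb (by positivity) hcb
    (fun t _ => (ha q t).hasDerivWithinAt) (fun t _ => (ha1 q t).hasDerivWithinAt)
    (fun t => hasDerivAt_sourceMode L H A B w q t) (fun t => abs_sourceMode_le L H A B w q t)
    (h0 q) (h10 q) ht htR
  set X := 1 + Real.exp R * ((κ * τq) ^ 2 + κ ^ 2 * (1 + α * D * ν ^ 2 * τq ^ 2 / 2)) + |κ * τq|
    with hX
  have hXY : X ≤ Y * ν ^ 2 := by
    have : Y * ν ^ 2 - X = (1 + Real.exp R * ((κ * τq) ^ 2 + κ ^ 2) + |κ * τq|) * (ν ^ 2 - 1) := by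
      rw [hX, hY]; ring
    have h2 : 0 ≤ (1 + Real.exp R * ((κ * τq) ^ 2 + κ ^ 2) + |κ * τq|) * (ν ^ 2 - 1) :=
      mul_nonneg (by positivity) (by linarith)
    linarith
  have hX0 : 0 ≤ X := by positivity
  have f1 : |a q t| ≤ τq * Y * ν ^ 2 := by
    refine e1.trans ?_
    rw [div_div_eq_mul_div]
    refine (div_le_self (by positivity) ?_).trans ?_
    · have : 0 ≤ α * τT * Λ := by positivity
      linarith
    · rw [mul_comm, mul_assoc]
      exact mul_le_mul_of_nonneg_left hXY hτ.le
  have f2 : |a1 q t| ≤ 2 * Y * ν ^ 2 := by linarith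
  have f3 : |κ * (sourceMode L H A B w q t + τq * sourceModeDeriv L H A B w q t)
        - (1 + α * τT * Λ) / τq * a1 q t - α * Λ / τq * a q t|
      ≤ (|κ| * (1 + τq * D1) + b0 * (2 * Y) + α * D / τq * (τq * Y)) * ν ^ 4 := by
    have g1 : |κ * (sourceMode L H A B w q t + τq * sourceModeDeriv L H A B w q t)|
        ≤ |κ| * (1 + τq * D1) * ν ^ 4 := by
      rw [abs_mul, mul_assoc]
      gcongr
      refine (abs_add_le _ _).trans ?_
      rw [abs_mul, abs_of_pos hτ]
      have : ν ≤ ν ^ 4 := le_self_pow₀ hν (by norm_num)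
      calc _ ≤ 1 + τq * (D1 * ν) := by gcongr
        _ ≤ ν ^ 4 + τq * (D1 * ν ^ 4) := by gcongr; exact one_le_pow₀ hν
        _ = _ := by ring
    have g2 : |(1 + α * τT * Λ) / τq * a1 q t| ≤ b0 * (2 * Y) * ν ^ 4 := by
      rw [abs_mul, abs_of_pos hb]
      have : (1 + α * τT * Λ) / τq ≤ b0 * ν ^ 2 := by
        rw [hb0, div_mul_eq_mul_div]
        gcongr
        have : α * τT * Λ ≤ α * τT * (D * ν ^ 2) := by gcongr
        exact (add_le_add hν2 this).trans (le_of_eq (by ring))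
      calc _ ≤ b0 * ν ^ 2 * (2 * Y * ν ^ 2) := by gcongr
        _ = _ := by ring
    have g3 : |α * Λ / τq * a q t| ≤ α * D / τq * (τq * Y) * ν ^ 4 := by
      rw [abs_mul, abs_of_pos (by positivity : 0 < α * Λ / τq)]
      calc _ ≤ α * (D * ν ^ 2) / τq * (τq * Y * ν ^ 2) := by gcongr
        _ = _ := by ring
    calc _ ≤ _ := (abs_sub _ _).trans (add_le_add ((abs_sub _ _).trans (add_le_add g1 g2)) g3)
      _ = _ := by ring
  have hν4 : ν ^ 2 ≤ ν ^ 4 := pow_le_pow_right₀ hν (by norm_num)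
  set Z := |κ| * (1 + τq * D1) + b0 * (2 * Y) + α * D / τq * (τq * Y) with hZ
  have hZ0 : 0 ≤ Z := by positivity
  have h1 : τq * Y * ν ^ 2 ≤ τq * Y * ν ^ 4 := by gcongr
  have h2 : 2 * Y * ν ^ 2 ≤ 2 * Y * ν ^ 4 := by gcongr
  have p1 : 0 ≤ τq * Y * ν ^ 4 := by positivity
  have p2 : 0 ≤ 2 * Y * ν ^ 4 := by positivity
  have p3 : 0 ≤ Z * ν ^ 4 := by positivity
  refine ⟨?_, ?_, ?_⟩ <;> linarith

/-- With a positive thermal lag the modes decay like `1 / (m n)`. -/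
theorem dplMode_decay {L H α τq τT κ A B w t : ℝ} (hL : 0 < L) (hH : 0 < H) (hα : 0 < α)
    (hτ : 0 < τq) (hT : 0 < τT) {a a1 : ℕ × ℕ → ℝ → ℝ} (h0 : ∀ q, a q 0 = 0)
    (h10 : ∀ q, a1 q 0 = 0) (ha : ∀ q t, HasDerivAt (a q) (a1 q t) t)
    (ha1 : ∀ q t, HasDerivAt (a1 q) (κ
          * (sourceMode L H A B w q t + τq * sourceModeDeriv L H A B w q t)
        - (1 + α * τT * lambdaSq L H (q.1 + 1) (q.2 + 1)) / τq * a1 q t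
        - α * lambdaSq L H (q.1 + 1) (q.2 + 1) / τq * a q t) t) (ht : 0 ≤ t) :
    ∃ C : ℝ, ∀ q, |a q t| ≤ C / modeWeight q := by
  set Y := 1 + Real.exp t * ((κ * τq) ^ 2 + κ ^ 2 * (1 + 1 / τT * τq ^ 2 / 2)) + |κ * τq| with hY
  have hY0 : 0 ≤ Y := by positivity
  refine ⟨Y * τq / (α * τT * (2 * (Real.pi ^ 2 / (L * H)))), fun q => ?_⟩
  have hν0 := modeWeight_pos q
  have hΛ0 := lambdaSq_pos hL H q
  have hΛ := le_lambdaSq hL hH q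
  set Λ := lambdaSq L H (q.1 + 1) (q.2 + 1)
  have hb : 0 < (1 + α * τT * Λ) / τq := by positivity
  -- The thermal lag makes the damping grow like λ², so c/b stays bounded over all modes and the
  -- factor 1/b is O(1/λ²).
  have hcb : α * Λ / τq / ((1 + α * τT * Λ) / τq) ≤ 1 / τT := by
    rw [div_div_div_cancel_right₀ hτ.ne', div_le_div_iff₀ (by positivity) hT]
    nlinarith
  refine (damped_bounds hb (by positivity) hcb
    (fun t _ => (ha q t).hasDerivWithinAt) (fun t _ => (ha1 q t).hasDerivWithinAt)
    (fun t => hasDerivAt_sourceMode L H A B w q t) (fun t => abs_sourceMode_le L H A B w q t)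
    (h0 q) (h10 q) ht le_rfl).1.trans ?_
  rw [← hY, div_div_eq_mul_div, div_div]
  gcongr
  calc α * τT * (2 * (Real.pi ^ 2 / (L * H))) * modeWeight q
      = α * τT * (2 * (Real.pi ^ 2 / (L * H)) * modeWeight q) := by ring
    _ ≤ α * τT * Λ := by gcongr
    _ ≤ _ := by linarith

/-! ### Solutions of the dual-phase-lag equation -/

/-- Locally uniform polynomial bounds give locally uniform summable bounds after pairing. -/
theorem exists_summable_pairing_bound {L H : ℝ} (hL : 0 < L) (hH : 0 < H) {f : ℕ × ℕ → ℝ → ℝ}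
    {K : ℕ} (hf : ∀ R, ∃ C : ℝ, ∀ q t, 0 ≤ t → t ≤ R → |f q t| ≤ C * modeWeight q ^ K)
    {φ : ℝ × ℝ → ℝ} (h : IsDirichletTest L H φ) (R : ℝ) :
    ∃ u : ℕ × ℕ → ℝ, Summable u ∧ ∀ q t, 0 ≤ t → t ≤ R → |f q t * sineCoeff L H q φ| ≤ u q := by
  obtain ⟨C, hC⟩ := hf R
  refine ⟨_, (summable_sineCoeff hL hH h K).mul_left C, fun q t ht htR => ?_⟩
  rw [abs_mul]
  calc _ ≤ C * modeWeight q ^ K * |sineCoeff L H q φ| := by gcongr; exact hC q t ht htR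
    _ = _ := by ring

/-- The polynomial bounds on a' and a'' permit differentiating the paired series twice. The equation
then holds term by term, since the Laplacian multiplies a sine coefficient by -λ². -/
theorem isDPLSolution_of_hasSum {L H α k τq τT Θ A B w : ℝ} (hL : 0 < L) (hH : 0 < H) (hα : 0 < α)
    (hk : 0 < k) (hτ : 0 < τq) (hT : 0 ≤ τT) {a a1 : ℕ × ℕ → ℝ → ℝ} (h0 : ∀ q, a q 0 = 0)
    (h10 : ∀ q, a1 q 0 = 0) (ha : ∀ q t, HasDerivAt (a q) (a1 q t) t)
    (ha1 : ∀ q t, HasDerivAt (a1 q) (4 * α * Θ / (L * H * τq * k)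
          * (sourceMode L H A B w q t + τq * sourceModeDeriv L H A B w q t)
        - (1 + α * τT * lambdaSq L H (q.1 + 1) (q.2 + 1)) / τq * a1 q t
        - α * lambdaSq L H (q.1 + 1) (q.2 + 1) / τq * a q t) t)
    {T : ℝ → DirichletDistribution L H}
    (hTs : ∀ t, 0 ≤ t → ∀ φ : DirichletTest L H,
      HasSum (fun q => a q t * sineCoeff L H q φ) (T t φ)) :
    IsDPLSolution L H α k τq τT Θ A B w T := by
  set a2 : ℕ × ℕ → ℝ → ℝ := fun q t => 4 * α * Θ / (L * H * τq * k)
          * (sourceMode L H A B w q t + τq * sourceModeDeriv L H A B w q t)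
        - (1 + α * τT * lambdaSq L H (q.1 + 1) (q.2 + 1)) / τq * a1 q t
        - α * lambdaSq L H (q.1 + 1) (q.2 + 1) / τq * a q t with ha2
  have hbd : ∀ R, ∃ C : ℝ, ∀ q t, 0 ≤ t → t ≤ R → |a q t| ≤ C * modeWeight q ^ 4 ∧
      |a1 q t| ≤ C * modeWeight q ^ 4 ∧ |a2 q t| ≤ C * modeWeight q ^ 4 := fun R =>
    dplMode_bound hL hH hα hτ hT h0 h10 ha ha1
  have hbd1 : ∀ R, ∃ C : ℝ, ∀ q t, 0 ≤ t → t ≤ R → |a1 q t| ≤ C * modeWeight q ^ 4 := fun R =>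
    (hbd R).imp fun C h q t h1 h2 => (h q t h1 h2).2.1
  have hbd2 : ∀ R, ∃ C : ℝ, ∀ q t, 0 ≤ t → t ≤ R → |a2 q t| ≤ C * modeWeight q ^ 4 := fun R =>
    (hbd R).imp fun C h q t h1 h2 => (h q t h1 h2).2.2
  have ca : ∀ q, Continuous (a q) := fun q =>
    continuous_iff_continuousAt.2 fun t => (ha q t).continuousAt
  have ca1 : ∀ q, Continuous (a1 q) := fun q =>
    continuous_iff_continuousAt.2 fun t => (ha1 q t).continuousAt
  have ca2 : ∀ q, Continuous (a2 q) := fun q => by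
    have c1 := continuous_sourceMode L H A B w q
    have c2 := continuous_sourceModeDeriv L H A B w q
    have c3 := ca q
    have c4 := ca1 q
    simp only [ha2]
    fun_prop
  have s1 : ∀ (φ : DirichletTest L H) t, 0 ≤ t → Summable fun q => a1 q t * sineCoeff L H q φ :=
    fun φ t ht => by
      obtain ⟨u, hu, hb⟩ := exists_summable_pairing_bound hL hH hbd1 φ.2 t
      exact Summable.of_norm_bounded hu fun q => hb q t ht le_rfl
  have s2 : ∀ (φ : DirichletTest L H) t, 0 ≤ t → Summable fun q => a2 q t * sineCoeff L H q φ :=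
    fun φ t ht => by
      obtain ⟨u, hu, hb⟩ := exists_summable_pairing_bound hL hH hbd2 φ.2 t
      exact Summable.of_norm_bounded hu fun q => hb q t ht le_rfl
  have d1 : ∀ (φ : DirichletTest L H) t, 0 ≤ t → HasDerivWithinAt (fun t => T t φ)
      (∑' q, a1 q t * sineCoeff L H q φ) (Set.Ici 0) t := fun φ t ht => by
    have h := hasDerivWithinAt_tsum_Ici (f := fun q t => a q t * sineCoeff L H q φ)
      (fun q t _ => ((ha q t).mul_const (sineCoeff L H q φ)).hasDerivWithinAt)
      (fun q => ((ca1 q).mul_const _).continuousOn)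
      (exists_summable_pairing_bound hL hH hbd1 φ.2) (by simp [h0, summable_zero]) ht
    exact h.congr (fun s hs => (hTs s hs φ).tsum_eq.symm) (hTs t ht φ).tsum_eq.symm
  have d2 : ∀ (φ : DirichletTest L H) t, 0 ≤ t →
      HasDerivWithinAt (fun t => ∑' q, a1 q t * sineCoeff L H q φ)
      (∑' q, a2 q t * sineCoeff L H q φ) (Set.Ici 0) t := fun φ t ht =>
    hasDerivWithinAt_tsum_Ici (f := fun q t => a1 q t * sineCoeff L H q φ)
      (fun q t _ => ((ha1 q t).mul_const (sineCoeff L H q φ)).hasDerivWithinAt)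
      (fun q => ((ca2 q).mul_const _).continuousOn)
      (exists_summable_pairing_bound hL hH hbd2 φ.2) (by simp [h10, summable_zero]) ht
  have c2 : ∀ φ : DirichletTest L H,
      ContinuousOn (fun t => ∑' q, a2 q t * sineCoeff L H q φ) (Set.Ici 0) := fun φ =>
    continuousOn_tsum_Ici (fun q => ((ca2 q).mul_const _).continuousOn)
      (exists_summable_pairing_bound hL hH hbd2 φ.2)
  refine ⟨fun φ => contDiffOn_two_Ici (d1 φ) (d2 φ) (c2 φ), fun φ t ht => ?_, fun φ => ?_,
    fun φ => ?_⟩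
  · rw [derivWithin_Ici ht (d1 (testLaplacian φ) t ht), derivWithin_Ici ht (d1 φ t ht),
      iteratedDerivWithin_two_Ici (d1 φ) ht (d2 φ t ht)]
    have l1 := ((hTs t ht (testLaplacian φ)).add
      ((s1 (testLaplacian φ) t ht).hasSum.mul_left τT)).add
      (((hasSum_heatSource hL hH Θ A B w t φ).add
        ((hasSum_deriv_heatSource hL hH Θ A B w t φ).mul_left τq)).mul_left (1 / k))
    have r1 := ((s1 φ t ht).hasSum.add ((s2 φ t ht).hasSum.mul_left τq)).mul_left (1 / α)
    refine l1.unique ((congrArg (fun G => HasSum G _) (funext fun q => ?_)).mpr r1)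
    change a q t * sineCoeff L H q (planeLaplacian φ)
      + τT * (a1 q t * sineCoeff L H q (planeLaplacian φ)) + _ = _
    rw [sineCoeff_planeLaplacian hL hH φ.2]
    simp only [ha2]
    field_simp
    ring
  · have h := hTs 0 le_rfl φ
    simp only [h0, zero_mul] at h
    exact h.unique hasSum_zero
  · rw [derivWithin_Ici le_rfl (d1 φ 0 le_rfl)]
    simp [h10]

/-- Tested on a mode, and scaled by 4/(LH), a solution satisfies the same scalar problem as a; by
`damped_unique` they coincide, and the values on the modes determine the distribution. -/
theorem IsDPLSolution.hasSum {L H α k τq τT Θ A B w : ℝ} (hL : 0 < L) (hH : 0 < H) (hα : 0 < α)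
    (hk : 0 < k) (hτ : 0 < τq) (hT : 0 ≤ τT) {a a1 : ℕ × ℕ → ℝ → ℝ} (h0 : ∀ q, a q 0 = 0)
    (h10 : ∀ q, a1 q 0 = 0) (ha : ∀ q t, HasDerivAt (a q) (a1 q t) t)
    (ha1 : ∀ q t, HasDerivAt (a1 q) (4 * α * Θ / (L * H * τq * k)
          * (sourceMode L H A B w q t + τq * sourceModeDeriv L H A B w q t)
        - (1 + α * τT * lambdaSq L H (q.1 + 1) (q.2 + 1)) / τq * a1 q t
        - α * lambdaSq L H (q.1 + 1) (q.2 + 1) / τq * a q t) t)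
    {T : ℝ → DirichletDistribution L H} (hsol : IsDPLSolution L H α k τq τT Θ A B w T)
    {t : ℝ} (ht : 0 ≤ t) (φ : DirichletTest L H) :
    HasSum (fun q => a q t * sineCoeff L H q φ) (T t φ) := by
  have key : ∀ q, 4 / (L * H) * T t (sineTest hL hH q) = a q t := by
    intro q
    set e := sineTest hL hH q with he
    set Λ := lambdaSq L H (q.1 + 1) (q.2 + 1) with hΛ
    have hΛ0 : 0 < Λ := lambdaSq_pos hL H q
    set y : ℝ → ℝ := fun s => T s e with hy
    have hc := hsol.contDiffOn e
    have hd1 : ∀ s, 0 ≤ s → HasDerivWithinAt y (derivWithin y (Set.Ici 0) s) (Set.Ici 0) s :=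
      fun s hs => (hc.of_le (by norm_num)).hasDerivWithinAt_Ici hs
    have hlap : ∀ s, T s (testLaplacian e) = -Λ * y s := fun s => by
      rw [he, testLaplacian_sineTest, map_smul, smul_eq_mul]
    have hsrc : (fun s => heatSource L H Θ A B w s e) = fun s => Θ * sourceMode L H A B w q s := rfl
    refine damped_unique (b := (1 + α * τT * Λ) / τq) (c := α * Λ / τq)
      (a := fun s => 4 / (L * H) * y s) (a1 := fun s => 4 / (L * H) * derivWithin y (Set.Ici 0) s)
      (by positivity) (by positivity)
      (fun s hs => (hd1 s hs).const_mul _) (fun s hs => ?_)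
      (fun s hs => (ha q s).hasDerivWithinAt) (fun s hs => (ha1 q s).hasDerivWithinAt)
      ?_ ?_ ht
    · refine ((hc.hasDerivWithinAt_derivWithin_Ici hs).const_mul _).congr_deriv ?_
      have heq := hsol.equation e s hs
      simp only [hlap] at heq
      rw [hsrc, ((hasDerivAt_sourceMode L H A B w q s).const_mul Θ).deriv,
        derivWithin_Ici hs ((hd1 s hs).const_mul (-Λ)), show heatSource L H Θ A B w s e
          = Θ * sourceMode L H A B w q s from rfl] at heq
      have h2 : iteratedDerivWithin 2 y (Set.Ici 0) s = (α * (-Λ * y s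
          + τT * (-Λ * derivWithin y (Set.Ici 0) s) + 1 / k * (Θ * sourceMode L H A B w q s
            + τq * (Θ * sourceModeDeriv L H A B w q s))) - derivWithin y (Set.Ici 0) s) / τq := by
        rw [heq]
        field_simp
        ring
      change 4 / (L * H) * iteratedDerivWithin 2 y (Set.Ici 0) s = _
      rw [h2]
      field_simp
      ring
    · simp only [hy, hsol.initial, h0, mul_zero]
    · have := hsol.initial_deriv e
      change derivWithin y (Set.Ici 0) 0 = 0 at this
      simp only [this, h10, mul_zero]
  refine (congrArg (fun G => HasSum G _) (funext fun q => ?_)).mpr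
    ((T t).hasSum_sineCoeff hL hH φ)
  rw [← key]
  ring

theorem exists_hasSum_family {L H : ℝ} (hL : 0 < L) (hH : 0 < H) {a : ℕ × ℕ → ℝ → ℝ} {K : ℕ}
    (hbd : ∀ t, 0 ≤ t → ∃ C : ℝ, ∀ q, |a q t| ≤ C * modeWeight q ^ K) :
    ∃ T : ℝ → DirichletDistribution L H, ∀ t, 0 ≤ t → ∀ φ : DirichletTest L H,
      HasSum (fun q => a q t * sineCoeff L H q φ) (T t φ) := by
  have h : ∀ t, ∃ S : DirichletDistribution L H, 0 ≤ t → ∀ φ : DirichletTest L H,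
      HasSum (fun q => a q t * sineCoeff L H q φ) (S φ) := fun t => by
    by_cases ht : 0 ≤ t
    · obtain ⟨C, hC⟩ := hbd t ht
      obtain ⟨S, hS⟩ := exists_distribution hL hH hC
      exact ⟨S, fun _ => hS⟩
    · exact ⟨pointSource L H 0 0 0, fun h => absurd h ht⟩
  choose T hT using h
  exact ⟨T, hT⟩

/-! ### Square-integrable sine series -/

theorem freq_injective {L : ℝ} (hL : 0 < L) {m n : ℕ}
    (h : freq L (m + 1) ^ 2 = freq L (n + 1) ^ 2) : m = n := by
  have h1 := (pow_left_inj₀ (freq_pos hL m).le (freq_pos hL n).le two_ne_zero).1 h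
  unfold freq at h1
  have h2 : ((m + 1 : ℕ) : ℝ) = ((n + 1 : ℕ) : ℝ) := by
    field_simp at h1
    exact h1
  exact Nat.succ_injective (by exact_mod_cast h2)

/-- Each second partial derivative is symmetric against the modes, so a nonzero pairing would force
both pairs of eigenvalues μ² and γ² to agree. Using λ² alone would not do, as it can be degenerate.
-/
theorem sineCoeff_sineMode_of_ne {L H : ℝ} (hL : 0 < L) (hH : 0 < H) {q r : ℕ × ℕ} (h : q ≠ r) :
    sineCoeff L H q (sineMode L H (r.1 + 1) (r.2 + 1)) = 0 := by
  have ht := isDirichletTest_sineMode hL hH (r.1 + 1) (r.2 + 1)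
  have hx := sineCoeff_partialX_partialX hL hH ht q
  have hy := sineCoeff_partialY_partialY hL hH ht q
  rw [partialX_partialX_sineMode, sineCoeff_smul] at hx
  rw [partialY_partialY_sineMode, sineCoeff_smul] at hy
  by_contra h0
  have ex := mul_right_cancel₀ h0 hx
  have ey := mul_right_cancel₀ h0 hy
  exact h (Prod.ext (freq_injective hL (by linarith)) (freq_injective hH (by linarith)))

instance isFiniteMeasure_plate (L H : ℝ) : IsFiniteMeasure (volume.restrict (plate L H)) :=
  ⟨by
    rw [Measure.restrict_apply_univ]
    exact (isCompact_Icc.prod isCompact_Icc : IsCompact (plate L H)).measure_lt_top⟩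

theorem memLp_plate (L H : ℝ) {f : ℝ × ℝ → ℝ} (hf : Continuous f) :
    MemLp f 2 (volume.restrict (plate L H)) := by
  obtain ⟨C, hC⟩ := (isCompact_Icc.prod isCompact_Icc : IsCompact (plate L H))
    |>.exists_bound_of_continuousOn hf.continuousOn
  refine MemLp.of_bound hf.aestronglyMeasurable C ?_
  exact (ae_restrict_iff' (measurableSet_Icc.prod measurableSet_Icc)).2 (ae_of_all _ hC)

/-- A continuous function as an element of `L²` of the plate. -/
def plateL2 (L H : ℝ) {f : ℝ × ℝ → ℝ} (hf : Continuous f) :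
    Lp ℝ 2 (volume.restrict (plate L H)) :=
  (memLp_plate L H hf).toLp f

theorem plateL2_coeFn (L H : ℝ) {f : ℝ × ℝ → ℝ} (hf : Continuous f) :
    plateL2 L H hf =ᵐ[volume.restrict (plate L H)] f := MemLp.coeFn_toLp _

theorem inner_plateL2_left (L H : ℝ) {f : ℝ × ℝ → ℝ} (hf : Continuous f)
    (g : Lp ℝ 2 (volume.restrict (plate L H))) :
    inner ℝ (plateL2 L H hf) g = ∫ p in plate L H, g p * f p := by
  rw [L2.inner_def]
  refine integral_congr_ae ?_
  filter_upwards [plateL2_coeFn L H hf] with p hp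
  rw [hp]
  simp [mul_comm]

theorem inner_plateL2 (L H : ℝ) {f g : ℝ × ℝ → ℝ} (hf : Continuous f) (hg : Continuous g) :
    inner ℝ (plateL2 L H hf) (plateL2 L H hg) = ∫ p in plate L H, g p * f p := by
  rw [inner_plateL2_left]
  refine integral_congr_ae ?_
  filter_upwards [plateL2_coeFn L H hg] with p hp
  rw [hp]

theorem Lp_sum_ae_eq {ι X : Type*} [MeasurableSpace X] {μ : Measure X} (v : ι → Lp ℝ 2 μ)
    (f : ι → X → ℝ) (h : ∀ i, v i =ᵐ[μ] f i) (F : Finset ι) :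
    (∑ i ∈ F, v i : Lp ℝ 2 μ) =ᵐ[μ] fun p => ∑ i ∈ F, f i p := by
  classical
  induction F using Finset.induction_on with
  | empty =>
    filter_upwards [Lp.coeFn_zero ℝ 2 μ] with p hp
    simp only [Finset.sum_empty, hp, Pi.zero_apply]
  | insert i F hi ih =>
    rw [Finset.sum_insert hi]
    filter_upwards [Lp.coeFn_add (v i) (∑ i ∈ F, v i), h i, ih] with p h1 h2 h3
    rw [h1, Pi.add_apply, h2, h3, Finset.sum_insert hi]

/-- A distribution whose sine coefficients are `O(1 / (m n))` is a square-integrable function, and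
its sine series converges in `L²`. -/
theorem exists_isL2SineSeries {L H : ℝ} (hL : 0 < L) (hH : 0 < H) {a : ℕ × ℕ → ℝ} {C : ℝ}
    (ha : ∀ q, |a q| ≤ C / modeWeight q) {c : ℕ → ℕ → ℂ}
    (hc : ∀ q : ℕ × ℕ, (a q : ℂ) = c (q.1 + 1) (q.2 + 1)) {T : DirichletDistribution L H}
    (hT : ∀ φ : DirichletTest L H, HasSum (fun q => a q * sineCoeff L H q φ) (T φ)) :
    ∃ θ : ℝ × ℝ → ℝ, IsL2SineSeries L H c T θ := by
  set e : ℕ × ℕ → Lp ℝ 2 (volume.restrict (plate L H)) := fun q =>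
    plateL2 L H (continuous_sineMode L H (q.1 + 1) (q.2 + 1)) with he
  have hin : ∀ q r, inner ℝ (e r) (e q) = sineCoeff L H q (sineMode L H (r.1 + 1) (r.2 + 1)) :=
    fun q r => inner_plateL2 ..
  -- Passing to the lines spanned by the modes gives the summability criterion without normalising
  -- them.
  have horth : OrthogonalFamily ℝ (fun q => Submodule.span ℝ {e q})
      (fun q => (Submodule.span ℝ {e q}).subtypeₗᵢ) := by
    refine OrthogonalFamily.of_pairwise fun q r hqr => ?_
    rw [Function.onFun, Submodule.isOrtho_span]
    intro u hu v hv
    rw [Set.mem_singleton_iff.1 hu, Set.mem_singleton_iff.1 hv, hin,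
      sineCoeff_sineMode_of_ne hL hH hqr.symm]
  have hnorm : ∀ q, ‖e q‖ ^ 2 ≤ L * H := fun q => by
    rw [← real_inner_self_eq_norm_sq, hin]
    have := abs_sineCoeff_le hL hH q (abs_sineMode_le L H (q.1 + 1) (q.2 + 1))
    rw [mul_one] at this
    exact (le_abs_self _).trans this
  have hsum : Summable fun q => a q • e q := by
    have h := (horth.summable_iff_norm_sq_summable (fun q => ⟨a q • e q,
      Submodule.smul_mem _ _ (Submodule.mem_span_singleton_self _)⟩)).2 (by
        refine Summable.of_nonneg_of_le (fun q => by positivity) (fun q => ?_)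
          (summable_modeWeight.mul_left (C ^ 2 * (L * H)))
        change ‖a q • e q‖ ^ 2 ≤ _
        rw [norm_smul, mul_pow, Real.norm_eq_abs]
        have h1 := pow_le_pow_left₀ (abs_nonneg _) (ha q) 2
        calc _ ≤ (C / modeWeight q) ^ 2 * (L * H) := by gcongr; exact hnorm q
          _ = _ := by rw [div_pow]; ring)
    exact h
  set θ := ∑' q, a q • e q with hθ
  have hθs : HasSum (fun q => a q • e q) θ := hsum.hasSum
  refine ⟨θ, Lp.memLp θ, fun φ => ?_, ?_⟩
  · have h1 := (innerSL ℝ (plateL2 L H φ.2.smooth.continuous)).hasSum hθs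
    simp only [innerSL_apply_apply, inner_smul_right, inner_plateL2_left L H _ θ] at h1
    refine (hT φ).unique ((congrArg (fun G => HasSum G _) (funext fun q => ?_)).mpr h1)
    congr 1
    exact (inner_plateL2 ..).symm
  · have h1 : Tendsto (fun F : Finset (ℕ × ℕ) => ‖θ - ∑ q ∈ F, a q • e q‖ₑ) atTop (𝓝 0) := by
      have h2 : Tendsto (fun F : Finset (ℕ × ℕ) => θ - ∑ q ∈ F, a q • e q) atTop (𝓝 0) := by
        have h3 : Tendsto (fun F : Finset (ℕ × ℕ) => ∑ q ∈ F, a q • e q) atTop (𝓝 θ) := hθs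
        simpa using h3.const_sub θ
      simpa using h2.enorm
    refine h1.congr fun F => ?_
    rw [Lp.enorm_def]
    refine eLpNorm_congr_norm_ae ?_
    have hae := Lp_sum_ae_eq (fun q => a q • e q)
      (fun q p => a q * sineMode L H (q.1 + 1) (q.2 + 1) p) (fun q => by
        filter_upwards [Lp.coeFn_smul (a q) (e q),
          plateL2_coeFn L H (continuous_sineMode L H (q.1 + 1) (q.2 + 1))] with p h1 h2
        rw [h1, Pi.smul_apply, h2, smul_eq_mul]) F
    filter_upwards [hae, Lp.coeFn_sub θ (∑ q ∈ F, a q • e q)] with p h1 h2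
    rw [h2, Pi.sub_apply, h1, ← Complex.norm_real]
    congr 1
    push_cast
    simp only [hc]

/-! ### The classical heat equation -/

theorem hasDerivAt_heatCoeff {L H α k : ℝ} (Θ A B w : ℝ) (q : ℕ × ℕ) (t : ℝ) :
    HasDerivAt (heatCoeff L H α k Θ A B w (q.1 + 1) (q.2 + 1))
      (4 * α * Θ / (L * H * k) * sourceMode L H A B w q t
        - α * lambdaSq L H (q.1 + 1) (q.2 + 1)
          * heatCoeff L H α k Θ A B w (q.1 + 1) (q.2 + 1) t) t := by
  have e : ∀ t, heatP L H α A B w (q.1 + 1) (q.2 + 1) t = ∫ τ in (0 : ℝ)..t,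
      sourceMode L H A B w q τ
        * Real.exp (-(α * lambdaSq L H (q.1 + 1) (q.2 + 1)) * (t - τ)) := fun t =>
    intervalIntegral.integral_congr fun τ _ => by
      rw [sourceMode, sineMode, neg_mul]; ring
  have h := (hasDerivAt_duhamel_exp (continuous_sourceMode L H A B w q)
    (α * lambdaSq L H (q.1 + 1) (q.2 + 1)) t).const_mul (4 * α * Θ / (L * H * k))
  have e2 : heatCoeff L H α k Θ A B w (q.1 + 1) (q.2 + 1) = fun t => 4 * α * Θ / (L * H * k)
      * ∫ τ in (0 : ℝ)..t, sourceMode L H A B w q τ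
        * Real.exp (-(α * lambdaSq L H (q.1 + 1) (q.2 + 1)) * (t - τ)) :=
    funext fun t => by rw [heatCoeff, e]
  rw [e2]
  exact h.congr_deriv (by ring)

theorem heatCoeff_zero (L H α k Θ A B w : ℝ) (m n : ℕ) : heatCoeff L H α k Θ A B w m n 0 = 0 := by
  simp [heatCoeff, heatP]

/-- The mode obeys a damped equation with rate αλ² and forcing bounded by the source amplitude. -/
theorem abs_heatCoeff_le {L H α k Θ A B w : ℝ} (hL : 0 < L) (hα : 0 < α) (q : ℕ × ℕ) {t : ℝ}
    (ht : 0 ≤ t) : |heatCoeff L H α k Θ A B w (q.1 + 1) (q.2 + 1) t|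
      ≤ |4 * α * Θ / (L * H * k)| / (α * lambdaSq L H (q.1 + 1) (q.2 + 1)) := by
  have hΛ := lambdaSq_pos hL H q
  refine abs_le_of_damped (R := t) (f := fun t => 4 * α * Θ / (L * H * k)
    * sourceMode L H A B w q t) (by positivity)
    (fun t _ => (hasDerivAt_heatCoeff Θ A B w q t).hasDerivWithinAt) (fun t _ _ => ?_)
    (heatCoeff_zero ..) ht le_rfl
  rw [abs_mul]
  exact mul_le_of_le_one_right (abs_nonneg _) (abs_sourceMode_le ..)

theorem abs_heatCoeff_le_div {L H α k Θ A B w : ℝ} (hL : 0 < L) (hH : 0 < H) (hα : 0 < α)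
    (q : ℕ × ℕ) {t : ℝ} (ht : 0 ≤ t) : |heatCoeff L H α k Θ A B w (q.1 + 1) (q.2 + 1) t|
      ≤ |4 * α * Θ / (L * H * k)| / (α * (2 * (Real.pi ^ 2 / (L * H)))) / modeWeight q := by
  refine (abs_heatCoeff_le hL hα q ht).trans ?_
  have hν := modeWeight_pos q
  rw [div_div, mul_assoc]
  refine div_le_div_of_nonneg_left (abs_nonneg _) (by positivity) ?_
  rw [mul_assoc]
  exact mul_le_mul_of_nonneg_left (le_lambdaSq hL hH q) hα.le

theorem isHeatSolution_of_hasSum {L H α k Θ A B w : ℝ} (hL : 0 < L) (hH : 0 < H) (hα : 0 < α)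
    (hk : 0 < k) {T : ℝ → DirichletDistribution L H}
    (hTs : ∀ t, 0 ≤ t → ∀ φ : DirichletTest L H,
      HasSum (fun q : ℕ × ℕ => heatCoeff L H α k Θ A B w (q.1 + 1) (q.2 + 1) t
        * sineCoeff L H q φ) (T t φ)) :
    IsHeatSolution L H α k Θ A B w T := by
  set a : ℕ × ℕ → ℝ → ℝ := fun q => heatCoeff L H α k Θ A B w (q.1 + 1) (q.2 + 1) with hadef
  set a1 : ℕ × ℕ → ℝ → ℝ := fun q t => 4 * α * Θ / (L * H * k) * sourceMode L H A B w q t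
        - α * lambdaSq L H (q.1 + 1) (q.2 + 1) * a q t with ha1
  have ha : ∀ q t, HasDerivAt (a q) (a1 q t) t := fun q t => hasDerivAt_heatCoeff Θ A B w q t
  have h0 : ∀ q, a q 0 = 0 := fun q => heatCoeff_zero ..
  have ca1 : ∀ q, Continuous (a1 q) := fun q => by
    have c1 := continuous_sourceMode L H A B w q
    have c2 : Continuous (a q) := continuous_iff_continuousAt.2 fun t => (ha q t).continuousAt
    simp only [ha1]
    fun_prop
  -- The decay 1/(αλ²) of a exactly compensates the factor αλ² in its equation, so a' is bounded
  -- uniformly over the modes.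
  have hbd : ∀ R, ∃ C : ℝ, ∀ q t, 0 ≤ t → t ≤ R → |a1 q t| ≤ C * modeWeight q ^ 0 := by
    refine fun R => ⟨2 * |4 * α * Θ / (L * H * k)|, fun q t ht _ => ?_⟩
    have hΛ := lambdaSq_pos hL H q
    have h1 := abs_heatCoeff_le (H := H) (k := k) (Θ := Θ) (A := A) (B := B) (w := w) hL hα q ht
    rw [le_div_iff₀ (by positivity)] at h1
    have h2 : |4 * α * Θ / (L * H * k) * sourceMode L H A B w q t|
        ≤ |4 * α * Θ / (L * H * k)| := by
      rw [abs_mul]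
      exact mul_le_of_le_one_right (abs_nonneg _) (abs_sourceMode_le ..)
    refine (abs_sub _ _).trans ?_
    rw [abs_mul (α * _), abs_of_pos (by positivity : 0 < α * lambdaSq L H (q.1 + 1) (q.2 + 1))]
    linarith
  have s1 : ∀ (φ : DirichletTest L H) t, 0 ≤ t → Summable fun q => a1 q t * sineCoeff L H q φ :=
    fun φ t ht => by
      obtain ⟨u, hu, hb⟩ := exists_summable_pairing_bound hL hH hbd φ.2 t
      exact Summable.of_norm_bounded hu fun q => hb q t ht le_rfl
  have d1 : ∀ (φ : DirichletTest L H) t, 0 ≤ t → HasDerivWithinAt (fun t => T t φ)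
      (∑' q, a1 q t * sineCoeff L H q φ) (Set.Ici 0) t := fun φ t ht => by
    have h := hasDerivWithinAt_tsum_Ici (f := fun q t => a q t * sineCoeff L H q φ)
      (fun q t _ => ((ha q t).mul_const (sineCoeff L H q φ)).hasDerivWithinAt)
      (fun q => ((ca1 q).mul_const _).continuousOn)
      (exists_summable_pairing_bound hL hH hbd φ.2) (by simp [h0, summable_zero]) ht
    exact h.congr (fun s hs => (hTs s hs φ).tsum_eq.symm) (hTs t ht φ).tsum_eq.symm
  refine ⟨fun φ => contDiffOn_one_Ici (d1 φ) (continuousOn_tsum_Ici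
    (fun q => ((ca1 q).mul_const _).continuousOn) (exists_summable_pairing_bound hL hH hbd φ.2)),
    fun φ t ht => ?_, fun φ => ?_⟩
  · rw [derivWithin_Ici ht (d1 φ t ht)]
    have l1 := (hTs t ht (testLaplacian φ)).add
      ((hasSum_heatSource hL hH Θ A B w t φ).mul_left (1 / k))
    have r1 := (s1 φ t ht).hasSum.mul_left (1 / α)
    refine l1.unique ((congrArg (fun G => HasSum G _) (funext fun q => ?_)).mpr r1)
    change a q t * sineCoeff L H q (planeLaplacian φ) + _ = _
    rw [sineCoeff_planeLaplacian hL hH φ.2]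
    simp only [ha1]
    field_simp
    ring
  · have h := hTs 0 le_rfl φ
    simp only [heatCoeff_zero, zero_mul] at h
    exact h.unique hasSum_zero

theorem IsHeatSolution.hasSum {L H α k Θ A B w : ℝ} (hL : 0 < L) (hH : 0 < H) (hα : 0 < α)
    (hk : 0 < k) {T : ℝ → DirichletDistribution L H} (hsol : IsHeatSolution L H α k Θ A B w T)
    {t : ℝ} (ht : 0 ≤ t) (φ : DirichletTest L H) :
    HasSum (fun q : ℕ × ℕ => heatCoeff L H α k Θ A B w (q.1 + 1) (q.2 + 1) t
      * sineCoeff L H q φ) (T t φ) := by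
  have key : ∀ q : ℕ × ℕ, 4 / (L * H) * T t (sineTest hL hH q)
      = heatCoeff L H α k Θ A B w (q.1 + 1) (q.2 + 1) t := by
    intro q
    set e := sineTest hL hH q with he
    set Λ := lambdaSq L H (q.1 + 1) (q.2 + 1) with hΛ
    have hΛ0 : 0 < Λ := lambdaSq_pos hL H q
    set y : ℝ → ℝ := fun s => T s e with hy
    have hlap : ∀ s, T s (testLaplacian e) = -Λ * y s := fun s => by
      rw [he, testLaplacian_sineTest, map_smul, smul_eq_mul]
    -- The difference of the two candidates satisfies y' = -αΛy with zero initial value; zero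
    -- forcing gives the bound 0.
    have h := abs_le_of_damped (R := t) (Y := 0) (b := α * Λ) (f := fun _ => 0)
      (y := fun s => 4 / (L * H) * y s - heatCoeff L H α k Θ A B w (q.1 + 1) (q.2 + 1) s)
      (by positivity) (fun s hs => ?_) (by simp)
      (by simp [hy, hsol.initial, heatCoeff_zero]) ht le_rfl
    · rw [zero_div, abs_nonpos_iff, sub_eq_zero] at h
      exact h
    · refine ((((hsol.contDiffOn e).hasDerivWithinAt_Ici hs).const_mul _).sub
        (hasDerivAt_heatCoeff Θ A B w q s).hasDerivWithinAt).congr_deriv ?_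
      have heq := hsol.equation e s hs
      rw [hlap, show heatSource L H Θ A B w s e = Θ * sourceMode L H A B w q s from rfl] at heq
      have h2 : derivWithin (fun s => T s e) (Set.Ici 0) s
          = α * (-Λ * y s + 1 / k * (Θ * sourceMode L H A B w q s)) := by
        rw [heq]; field_simp
      rw [h2]
      field_simp
      ring
  refine (congrArg (fun G => HasSum G _) (funext fun q => ?_)).mpr
    ((T t).hasSum_sineCoeff hL hH φ)
  rw [← key]
  ring

end

/-! ### Assembly of the existence, characterisation and L² statements. -/

theorem mainTheorem1
    (L H α k Θ A B w : ℝ) (hL : 0 < L) (hH : 0 < H) (hα : 0 < α) (hk : 0 < k)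
    (hA : 0 ≤ A) (hAL : A ≤ L / 2) (hB : 0 ≤ B) (hBH : B ≤ H / 2) :
    -- dual-phase-lag equation
    (∀ τq τT : ℝ, 0 < τq → 0 ≤ τT →
      (∃ T : ℝ → DirichletDistribution L H, IsDPLSolution L H α k τq τT Θ A B w T) ∧
      (∀ T : ℝ → DirichletDistribution L H,
        IsDPLSolution L H α k τq τT Θ A B w T ↔
          ∀ t, 0 ≤ t → IsDistribSineSeries L H
            (fun m n => dplCoeff L H α k τq τT Θ A B w m n t) (T t)) ∧
      (0 < τT → ∀ T : ℝ → DirichletDistribution L H,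
        IsDPLSolution L H α k τq τT Θ A B w T →
          ∃ θ : ℝ → ℝ × ℝ → ℝ, ∀ t, 0 ≤ t → IsL2SineSeries L H
            (fun m n => dplCoeff L H α k τq τT Θ A B w m n t) (T t) (θ t))) ∧
    -- classical heat equation, i.e. both phase lags equal to zero
    ((∃ T : ℝ → DirichletDistribution L H, IsHeatSolution L H α k Θ A B w T) ∧
      (∀ T : ℝ → DirichletDistribution L H,
        IsHeatSolution L H α k Θ A B w T ↔
          ∀ t, 0 ≤ t → IsDistribSineSeries L H
            (fun m n => (heatCoeff L H α k Θ A B w m n t : ℂ)) (T t)) ∧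
      (∀ T : ℝ → DirichletDistribution L H,
        IsHeatSolution L H α k Θ A B w T →
          ∃ θ : ℝ → ℝ × ℝ → ℝ, ∀ t, 0 ≤ t → IsL2SineSeries L H
            (fun m n => (heatCoeff L H α k Θ A B w m n t : ℂ)) (T t) (θ t))) := by
  refine ⟨fun τq τT hτ hT => ?_, ?_⟩
  · choose a a1 hc h0 h10 ha ha1 using exists_dplMode (α := α) hL hH hk hτ τT Θ A B w
    refine ⟨?_, fun T => ⟨fun h t ht => ?_, fun h => ?_⟩, fun hT' T h => ?_⟩
    · obtain ⟨T, hTs⟩ := exists_hasSum_family hL hH (a := a) (K := 4) fun t ht =>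
        (dplMode_bound (R := t) hL hH hα hτ hT h0 h10 ha ha1).imp
          fun C hC q => (hC q t ht le_rfl).1
      exact ⟨T, isDPLSolution_of_hasSum hL hH hα hk hτ hT h0 h10 ha ha1 hTs⟩
    · exact (isDistribSineSeries_ofReal (a := fun q => a q t) fun q => hc q t).2
        (h.hasSum hL hH hα hk hτ hT h0 h10 ha ha1 ht)
    · exact isDPLSolution_of_hasSum hL hH hα hk hτ hT h0 h10 ha ha1 fun t ht =>
        (isDistribSineSeries_ofReal (a := fun q => a q t) fun q => hc q t).1 (h t ht)
    · have key : ∀ t, ∃ θ, 0 ≤ t → IsL2SineSeries L H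
          (fun m n => dplCoeff L H α k τq τT Θ A B w m n t) (T t) θ := fun t => by
        by_cases ht : 0 ≤ t
        · obtain ⟨C, hC⟩ := dplMode_decay hL hH hα hτ hT' h0 h10 ha ha1 ht
          obtain ⟨θ, hθ⟩ := exists_isL2SineSeries hL hH hC
            (c := fun m n => dplCoeff L H α k τq τT Θ A B w m n t) (fun q => hc q t)
            (h.hasSum hL hH hα hk hτ hT h0 h10 ha ha1 ht)
          exact ⟨θ, fun _ => hθ⟩
        -- Nothing is claimed for negative times, so any function serves there.
        · exact ⟨0, fun h => absurd h ht⟩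
      choose θ hθ using key
      exact ⟨θ, hθ⟩
  · refine ⟨?_, fun T => ⟨fun h t ht => ?_, fun h => ?_⟩, fun T h => ?_⟩
    · obtain ⟨T, hTs⟩ := exists_hasSum_family hL hH
        (a := fun q => heatCoeff L H α k Θ A B w (q.1 + 1) (q.2 + 1)) (K := 0) fun t ht =>
        ⟨_, fun q => by
          rw [pow_zero, mul_one]
          exact (abs_heatCoeff_le_div hL hH hα q ht).trans
            (div_le_self (by positivity) (one_le_modeWeight q))⟩
      exact ⟨T, isHeatSolution_of_hasSum hL hH hα hk hTs⟩
    · exact (isDistribSineSeries_ofReal (fun q => rfl)).2 (h.hasSum hL hH hα hk ht)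
    · exact isHeatSolution_of_hasSum hL hH hα hk fun t ht =>
        (isDistribSineSeries_ofReal (fun q => rfl)).1 (h t ht)
    · have key : ∀ t, ∃ θ, 0 ≤ t → IsL2SineSeries L H
          (fun m n => (heatCoeff L H α k Θ A B w m n t : ℂ)) (T t) θ := fun t => by
        by_cases ht : 0 ≤ t
        · obtain ⟨θ, hθ⟩ := exists_isL2SineSeries hL hH
            (fun q => abs_heatCoeff_le_div hL hH hα q ht)
            (c := fun m n => (heatCoeff L H α k Θ A B w m n t : ℂ)) (fun q => rfl)
            (h.hasSum hL hH hα hk ht)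
          exact ⟨θ, fun _ => hθ⟩
        · exact ⟨0, fun h => absurd h ht⟩
      choose θ hθ using key
      exact ⟨θ, hθ⟩
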